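/- For an integer $\alpha\ge 1$ consider the boundary value problem $$(-1)^\alpha u^{(2\alpha)}(x)=v(x)\quad (x\in[0,1]),\qquad u^{(j)}(0)=u^{(j)}(1)=0\quad (0\le j\le \alpha-1) \tag{$*$}$$ for complex-valued functions, and let $c_\alpha$ denote its minimal eigenvalue, that is, the smallest real number $\lambda$ for which $(-1)^\alpha u^{(2\alpha)}=\lambda u$ on $[0,1]$ has a solution $u\in C^{2\alpha}[0,1]$, $u\not\equiv 0$, satisfying the boundary conditions in $(*)$. **Theorem.** (a) For every integer $\alpha\ge1$ the minimal eigenvalue $c_\alpha$ exists, and it has the following equivalent descriptions. - The Green operator $K_\alpha$ of $(*)$ exists and is unique, and $c_\alpha=1/\|K_\alpha\|$. Here $K_\alpha$ is the bounded operator on $L^2(0,1)$ given by $(K_\alpha v)(x)=\int_0^1G_\alpha(x,y)v(y)\,dy$, where $G_\alpha$ is the Green kernel of $(*)$, i.e. a real continuous function on $[0,1]^2$ such that for every $v\in C[0,1]$ the function $u(x)=\int_0^1G_\alpha(x,y)v(y)\,dy$ belongs to $C^{2\alpha}[0,1]$ and solves $(*)$; and $\|K_\alpha\|$ is the operator norm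 on $L^2(0,1)$. - $1/c_\alpha$ is the best constant in the Wirtinger–Sobolev inequality: it is the smallest real $C$ such that $$\int_0^1|u(x)|^2\,dx\le C\int_0^1|u^{(\alpha)}(x)|^2\,dx$$ for all $u\in C^\alpha[0,1]$ with $u^{(j)}(0)=u^{(j)}(1)=0$ for $0\le j\le\alpha-1$. (b) As $\alpha\to\infty$ through the positive integers, $$c_\alpha=\sqrt{8\pi\alpha}\,\Bigl(\frac{4\alpha}{e}\Bigr)^{2\alpha}\Bigl[1+O\Bigl(\frac1{\sqrt\alpha}\Bigr)\Bigr].$$ (c) For every integer $\alpha\ge1$, $$\frac{4\alpha-2}{4\alpha^2-\alpha}\cdot\frac{(4\alpha)!\,(\alpha!)^2}{((2\alpha)!)^2}\;\le\; c_\alpha\;\le\;\frac{4\alpha+1}{2\alpha+1}\cdot\frac{(4\alpha)!\,(\alpha!)^2}{((2\alpha)!)^2}.$$ -/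

import Mathlib

open Set MeasureTheory Filter Asymptotics

noncomputable section

/-- The homogeneous Dirichlet conditions `u^(j)(0) = u^(j)(1) = 0` for `0 ≤ j ≤ α - 1`.
All derivatives are derivatives on the closed interval `[0,1]` (one-sided at the endpoints). -/
def DirichletBC (α : ℕ) (u : ℝ → ℂ) : Prop :=
  ∀ j : ℕ, j < α →
    iteratedDerivWithin j u (Icc 0 1) 0 = 0 ∧ iteratedDerivWithin j u (Icc 0 1) 1 = 0

/-- `u ∈ C^{2α}[0,1]` is a classical solution of the boundary value problem
`(-1)^α u^(2α) = v` on `[0,1]`, `u^(j)(0) = u^(j)(1) = 0` for `j < α`. -/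
def SolvesBVP (α : ℕ) (v u : ℝ → ℂ) : Prop :=
  ContDiffOn ℝ ((2 * α : ℕ) : WithTop ℕ∞) u (Icc 0 1) ∧ DirichletBC α u ∧
    ∀ x ∈ Icc (0 : ℝ) 1, (-1 : ℂ) ^ α * iteratedDerivWithin (2 * α) u (Icc 0 1) x = v x

/-- The real eigenvalues of the boundary value problem: those `l` for which
`(-1)^α u^(2α) = l u` with the Dirichlet conditions has a solution that is
not identically zero on `[0,1]`. -/
def dirichletEigenvalues (α : ℕ) : Set ℝ :=
  {l | ∃ u : ℝ → ℂ, SolvesBVP α (fun x => (l : ℂ) * u x) u ∧ ∃ x ∈ Icc (0 : ℝ) 1, u x ≠ 0}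

/-- The constant `c_α`, the minimal eigenvalue of the boundary value problem (that the
minimum is attained is part of the theorem). -/
def cConst (α : ℕ) : ℝ := sInf (dirichletEigenvalues α)

/-- `G` is the Green kernel of the boundary value problem: a continuous kernel on `[0,1]²`
such that for every continuous right-hand side `v` the function `x ↦ ∫₀¹ G(x,y) v(y) dy`
is a solution. -/
def IsGreenKernel (α : ℕ) (G : ℝ → ℝ → ℝ) : Prop :=
  ContinuousOn (fun p : ℝ × ℝ => G p.1 p.2) (Icc 0 1 ×ˢ Icc 0 1) ∧
    ∀ v : ℝ → ℂ, ContinuousOn v (Icc 0 1) →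
      SolvesBVP α v (fun x => ∫ y in (0 : ℝ)..1, (G x y : ℂ) * v y)

/-- The complex Hilbert space `L²(0,1)`. -/
abbrev L2Unit : Type := Lp ℂ 2 ((volume : Measure ℝ).restrict (Ioo 0 1))

/-- `K` is the integral operator on `L²(0,1)` with kernel `G`. -/
def IsIntegralOperator (G : ℝ → ℝ → ℝ) (K : L2Unit →L[ℂ] L2Unit) : Prop :=
  ∀ v : L2Unit, ∀ᵐ x ∂((volume : Measure ℝ).restrict (Ioo 0 1)),
    K v x = ∫ y in (0 : ℝ)..1, (G x y : ℂ) * v y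

/-- `K` is the Green operator `K_α` of the boundary value problem: the integral operator
on `L²(0,1)` whose kernel is the Green kernel. -/
def IsGreenOperator (α : ℕ) (K : L2Unit →L[ℂ] L2Unit) : Prop :=
  ∃ G : ℝ → ℝ → ℝ, IsGreenKernel α G ∧ IsIntegralOperator G K

/-- The real constants `C` for which `∫₀¹ |u|² ≤ C ∫₀¹ |u^(α)|²` holds for all
`u ∈ C^α[0,1]` satisfying the Dirichlet conditions. -/
def wirtingerSobolevConstants (α : ℕ) : Set ℝ :=
  {C | ∀ u : ℝ → ℂ, ContDiffOn ℝ (α : WithTop ℕ∞) u (Icc 0 1) → DirichletBC α u →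
    ∫ x in (0 : ℝ)..1, ‖u x‖ ^ 2 ≤
      C * ∫ x in (0 : ℝ)..1, ‖iteratedDerivWithin α u (Icc 0 1) x‖ ^ 2}

end

/-!
The solution operator of the boundary value problem is studied through an explicit Green kernel.

**Green kernel.** Put `n = 2α - 1` and expand
`(x - y)^n = (x(1-y) - y(1-x))^n` binomially in `x(1-y)` and `y(1-x)`. The terms of index `k ≥ α` are
divisible by `x^α`, those with `k < α` by `(1-x)^α`. Subtracting the first group from the
fundamental solution `(x-y)_+^n` and multiplying by `(-1)^α / n!` gives a kernel that satisfies both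
sets of boundary conditions (`isGreenKernel_greenKernel`): seen from `0` the correction vanishes to
order `α`, and seen from `1` the repeated integral changes its base point and the complementary
group appears.

**Spectral description.** Integrating by parts `α` times yields the weak form
`∫ v φ̄ = ∫ u^(α) conj(φ^(α))` of the problem (`SolvesBVP.integral_mul_star`). It makes the Green
operator `K` symmetric and unique, makes every eigenvalue of the problem positive, and gives the
Wirtinger–Sobolev inequality with constant `‖K‖` by two applications of the Cauchy–Schwarz
inequality (`norm_mem_wirtingerSobolevConstants`). As `K` is compact and self-adjoint, `‖K‖` or
`-‖K‖` is an eigenvalue; an eigenvector has a smooth representative, so `1 / ‖K‖` is an eigenvalue of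
the problem (`one_div_norm_mem_dirichletEigenvalues`), and by the inequality it is the least one.

**Bounds.** Testing the inequality with `(x(1-x))^α`, whose derivative of order `2α` is constant,
bounds `c_α` from above (`le_of_mem_wirtingerSobolevConstants`). From below, `‖K‖` is at most the
trace `∫ G(x,x) dx`, a beta integral (`norm_le_of_isIntegralOperator_greenKernel`). This follows from
`|G(x,y)|² ≤ G(x,x) G(y,y)` (`abs_greenKernel_le`): in the variables `p = x(1-y)`, `q = y(1-x)` the
derivative of the kernel along `p - q = const` telescopes to `(pq)^(α-1) / ((α-1)!)²`, while `√(pq)`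
has derivative at least `1` there.

**Asymptotics.** Both bounds are `2 (1 + O(1/α))` times `(4α)! (α!)² / ((2α)!)²`, and Robbins' form of
Stirling's formula (`stirlingSeq_le`) turns this into the stated main term.
-/

noncomputable section


/-! ### Repeated integrals and polynomials -/

/-- The integration operator with base point `a`. -/
def primitiveFrom (a : ℝ) (V : ℝ → ℂ) : ℝ → ℂ := fun x => ∫ t in a..x, V t

lemma hasDerivAt_primitiveFrom {V : ℝ → ℂ} (hV : Continuous V) (a x : ℝ) :
    HasDerivAt (primitiveFrom a V) (V x) x :=
  intervalIntegral.integral_hasDerivAt_right (hV.intervalIntegrable _ _)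
    (hV.stronglyMeasurableAtFilter _ _) hV.continuousAt

lemma deriv_primitiveFrom {V : ℝ → ℂ} (hV : Continuous V) (a : ℝ) :
    deriv (primitiveFrom a V) = V :=
  funext fun x => (hasDerivAt_primitiveFrom hV a x).deriv

lemma continuous_primitiveFrom {V : ℝ → ℂ} (hV : Continuous V) (a : ℝ) :
    Continuous (primitiveFrom a V) :=
  continuous_iff_continuousAt.2 fun x => (hasDerivAt_primitiveFrom hV a x).continuousAt

lemma continuous_primitiveFrom_iterate {V : ℝ → ℂ} (hV : Continuous V) (a : ℝ) (m : ℕ) :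
    Continuous ((primitiveFrom a)^[m] V) := by
  induction m with
  | zero => exact hV
  | succ m ih => rw [Function.iterate_succ_apply']; exact continuous_primitiveFrom ih a

lemma contDiff_primitiveFrom_iterate {V : ℝ → ℂ} (hV : Continuous V) (a : ℝ) (m : ℕ) :
    ContDiff ℝ (m : WithTop ℕ∞) ((primitiveFrom a)^[m] V) := by
  induction m with
  | zero => exact contDiff_zero.2 hV
  | succ m ih =>
    have hc := continuous_primitiveFrom_iterate hV a m
    rw [Function.iterate_succ_apply']
    push_cast
    refine contDiff_succ_iff_deriv.2 ⟨fun x => (hasDerivAt_primitiveFrom hc a x).differentiableAt,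
      fun h => absurd h (by simp), ?_⟩
    rwa [deriv_primitiveFrom hc]

/-- **Cauchy's formula** for repeated integration. -/
lemma primitiveFrom_iterate_succ_apply (a x : ℝ) (m : ℕ) :
    ∀ {V : ℝ → ℂ}, Continuous V → (primitiveFrom a)^[m + 1] V x =
      ∫ y in a..x, ((x : ℂ) - y) ^ m / (m.factorial : ℂ) * V y := by
  induction m with
  | zero => intro V _; simp [primitiveFrom]
  | succ m ih =>
    intro V hV
    rw [Function.iterate_succ_apply, ih (continuous_primitiveFrom hV a)]
    have hu : ∀ y ∈ uIcc a x, HasDerivAt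
        (fun y : ℝ => ((x : ℂ) - y) ^ (m + 1) / ((m + 1).factorial : ℂ))
        (-(((x : ℂ) - y) ^ m / (m.factorial : ℂ))) y := by
      intro y _
      have h1 : HasDerivAt (fun y : ℝ => (x : ℂ) - (y : ℂ)) (-1) y := by
        simpa using (Complex.ofRealCLM.hasDerivAt (x := y)).const_sub (x : ℂ)
      have h2 := (h1.pow (m + 1)).div_const ((m + 1).factorial : ℂ)
      refine h2.congr_deriv ?_
      have : (m.factorial : ℂ) ≠ 0 := by exact_mod_cast m.factorial_ne_zero
      have : (m : ℂ) + 1 ≠ 0 := by exact_mod_cast m.succ_ne_zero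
      rw [Nat.factorial_succ]
      push_cast
      field_simp
    have hcont : Continuous fun y : ℝ => -(((x : ℂ) - y) ^ m / (m.factorial : ℂ)) := by fun_prop
    have h := intervalIntegral.integral_mul_deriv_eq_deriv_mul hu
      (fun y _ => hasDerivAt_primitiveFrom hV a y) (hcont.intervalIntegrable _ _)
      (hV.intervalIntegrable _ _)
    rw [h]
    simp [primitiveFrom, ← intervalIntegral.integral_neg]

lemma hasDerivAt_polynomial_eval_ofReal (p : Polynomial ℂ) (x : ℝ) :
    HasDerivAt (fun x : ℝ => p.eval (x : ℂ)) (p.derivative.eval (x : ℂ)) x :=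
  (p.hasDerivAt (x : ℂ)).comp_ofReal

lemma contDiff_polynomial_eval_ofReal (p : Polynomial ℂ) (k : WithTop ℕ∞) :
    ContDiff ℝ k fun x : ℝ => p.eval (x : ℂ) := by
  have h : ContDiff ℂ k fun z : ℂ => p.eval z := by simpa using p.contDiff_aeval (𝕜 := ℂ) k
  exact (h.restrict_scalars ℝ).comp Complex.ofRealCLM.contDiff

lemma iteratedDeriv_primitiveFrom_add_polynomial {V : ℝ → ℂ} (hV : Continuous V) (a : ℝ) (c : ℂ)
    (p : Polynomial ℂ) {j m : ℕ} (hj : j ≤ m) :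
    iteratedDeriv j (fun x : ℝ => c * (primitiveFrom a)^[m] V x + p.eval (x : ℂ)) =
      fun x : ℝ => c * (primitiveFrom a)^[m - j] V x +
        (Polynomial.derivative^[j] p).eval (x : ℂ) := by
  induction j with
  | zero => simp
  | succ j ih =>
    rw [iteratedDeriv_succ, ih (by omega)]
    funext x
    have hm : m - j = (m - (j + 1)) + 1 := by omega
    rw [hm, Function.iterate_succ_apply', Function.iterate_succ_apply']
    exact (((hasDerivAt_primitiveFrom (continuous_primitiveFrom_iterate hV a _) a x).const_mul
      c).add (hasDerivAt_polynomial_eval_ofReal _ x)).deriv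

lemma primitiveFrom_iterate_base (a : ℝ) (V : ℝ → ℂ) {m : ℕ} (hm : 0 < m) :
    (primitiveFrom a)^[m] V a = 0 := by
  obtain ⟨m, rfl⟩ := Nat.exists_eq_succ_of_ne_zero hm.ne'
  rw [Function.iterate_succ_apply']
  simp [primitiveFrom]

lemma eval_iterate_derivative_eq_zero {p : Polynomial ℂ} {t : ℂ} {m j : ℕ}
    (hp : (Polynomial.X - Polynomial.C t) ^ m ∣ p) (hj : j < m) :
    (Polynomial.derivative^[j] p).eval t = 0 := by
  have h := Polynomial.pow_sub_dvd_iterate_derivative_of_pow_dvd j hp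
  obtain ⟨q, hq⟩ := (dvd_pow_self (Polynomial.X - Polynomial.C t)
    (Nat.sub_ne_zero_of_lt hj)).trans h
  simp [hq]

/-- Derivatives on `[0,1]` may be computed from a smooth function on `ℝ` that agrees there. -/
lemma iteratedDerivWithin_Icc_eq {f F : ℝ → ℂ} {m j : ℕ} (hF : ContDiff ℝ (m : WithTop ℕ∞) F)
    (hf : EqOn f F (Icc 0 1)) (hj : j ≤ m) {x : ℝ} (hx : x ∈ Icc (0 : ℝ) 1) :
    iteratedDerivWithin j f (Icc 0 1) x = iteratedDeriv j F x := by
  rw [iteratedDerivWithin_congr hf hx]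
  exact iteratedDerivWithin_eq_iteratedDeriv (uniqueDiffOn_Icc one_pos)
    ((hF.of_le (by exact_mod_cast hj)).contDiffAt) hx

/-! ### The Green kernel -/

/-- The Green kernel of `(-1)^α u^(2α) = v` with Dirichlet conditions. The first term is the
fundamental solution; the sum consists of those terms of the binomial expansion of
`(x - y)^(2α-1) = (x(1-y) - y(1-x))^(2α-1)` that are divisible by `x^α`. -/
def greenKernel (α : ℕ) (x y : ℝ) : ℝ :=
  (-1) ^ α / ((2 * α - 1).factorial : ℝ) *
    (max (x - y) 0 ^ (2 * α - 1) - ∑ k ∈ Finset.Ico α (2 * α), ((2 * α - 1).choose k : ℝ) *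
      (x * (1 - y)) ^ k * (-(y * (1 - x))) ^ (2 * α - 1 - k))

lemma continuous_greenKernel (α : ℕ) : Continuous fun p : ℝ × ℝ => greenKernel α p.1 p.2 := by
  unfold greenKernel
  fun_prop

/-- The coefficient `∫₀¹ (1-y)^k (-y)^(n-k) V(y) dy` of `x^k (1-x)^(n-k)` (up to a binomial
coefficient) in `∫₀¹ (x-y)^n V(y) dy`. -/
def bernsteinMoment (n : ℕ) (V : ℝ → ℂ) (k : ℕ) : ℂ :=
  ∫ y in (0 : ℝ)..1, (1 - (y : ℂ)) ^ k * (-(y : ℂ)) ^ (n - k) * V y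

/-- The part of the Bernstein expansion of the polynomial `∫₀¹ (x-y)^n V(y) dy` indexed by `s`. -/
def bernsteinPart (n : ℕ) (V : ℝ → ℂ) (s : Finset ℕ) : Polynomial ℂ :=
  ∑ k ∈ s, Polynomial.C ((n.choose k : ℂ) * bernsteinMoment n V k) *
    (Polynomial.X ^ k * (1 - Polynomial.X) ^ (n - k))

lemma bernsteinPart_eval (n : ℕ) {V : ℝ → ℂ} (hV : Continuous V) (s : Finset ℕ) (x : ℝ) :
    (bernsteinPart n V s).eval (x : ℂ) =
      ∫ y in (0 : ℝ)..1, (∑ k ∈ s, (n.choose k : ℂ) * ((x : ℂ) * (1 - y)) ^ k *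
        (-((y : ℂ) * (1 - x))) ^ (n - k)) * V y := by
  simp_rw [Finset.sum_mul]
  rw [intervalIntegral.integral_finsetSum
    (fun k _ => (by fun_prop : Continuous _).intervalIntegrable _ _)]
  simp only [bernsteinPart, bernsteinMoment, Polynomial.eval_finsetSum, Polynomial.eval_mul,
    Polynomial.eval_C, Polynomial.eval_pow, Polynomial.eval_X, Polynomial.eval_sub,
    Polynomial.eval_one]
  refine Finset.sum_congr rfl fun k _ => ?_
  rw [mul_comm, ← mul_assoc, ← intervalIntegral.integral_const_mul]
  refine intervalIntegral.integral_congr fun y _ => ?_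
  rw [← neg_mul, mul_pow, mul_pow]
  ring

lemma bernsteinPart_range_eval (n : ℕ) {V : ℝ → ℂ} (hV : Continuous V) (x : ℝ) :
    (bernsteinPart n V (Finset.range (n + 1))).eval (x : ℂ) =
      ∫ y in (0 : ℝ)..1, ((x : ℂ) - y) ^ n * V y := by
  rw [bernsteinPart_eval n hV]
  refine intervalIntegral.integral_congr fun y _ => ?_
  have : (x : ℂ) - y = x * (1 - y) + -(y * (1 - x)) := by ring
  rw [this, add_pow]
  congr 1
  exact Finset.sum_congr rfl fun k _ => by ring

lemma natDegree_bernsteinPart_le (n : ℕ) (V : ℝ → ℂ) {s : Finset ℕ}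
    (hs : ∀ k ∈ s, k ≤ n) : (bernsteinPart n V s).natDegree ≤ n := by
  refine Polynomial.natDegree_sum_le_of_forall_le _ _ fun k hk => ?_
  refine (Polynomial.natDegree_C_mul_le _ _).trans (Polynomial.natDegree_mul_le.trans ?_)
  have h1 : (1 - Polynomial.X : Polynomial ℂ).natDegree ≤ 1 := by
    refine (Polynomial.natDegree_sub_le _ _).trans (by simp)
  have h2 := Polynomial.natDegree_pow_le_of_le (n - k) h1
  have := hs k hk
  rw [Polynomial.natDegree_X_pow]
  omega

lemma pow_dvd_bernsteinPart_zero (n : ℕ) (V : ℝ → ℂ) {s : Finset ℕ} {m : ℕ}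
    (hs : ∀ k ∈ s, m ≤ k) : (Polynomial.X - Polynomial.C 0) ^ m ∣ bernsteinPart n V s := by
  refine Finset.dvd_sum fun k hk => Dvd.dvd.mul_left (Dvd.dvd.mul_right ?_ _) _
  simpa using pow_dvd_pow _ (hs k hk)

lemma pow_dvd_bernsteinPart_one (n : ℕ) (V : ℝ → ℂ) {s : Finset ℕ} {m : ℕ}
    (hs : ∀ k ∈ s, m ≤ n - k) : (Polynomial.X - Polynomial.C 1) ^ m ∣ bernsteinPart n V s := by
  refine Finset.dvd_sum fun k hk => Dvd.dvd.mul_left (Dvd.dvd.mul_left ?_ _) _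
  refine (pow_dvd_pow _ (hs k hk)).trans (pow_dvd_pow_of_dvd ?_ _)
  exact ⟨-1, by simp⟩

/-- The solution `∫₀¹ G(x,y) V(y) dy`, written through the integral with base point `0`. -/
lemma integral_greenKernel {α : ℕ} (hα : 1 ≤ α) {V : ℝ → ℂ} (hV : Continuous V) {x : ℝ}
    (hx : x ∈ Icc (0 : ℝ) 1) :
    ∫ y in (0 : ℝ)..1, (greenKernel α x y : ℂ) * V y =
      (-1) ^ α / ((2 * α - 1).factorial : ℂ) *
        (((2 * α - 1).factorial : ℂ) * (primitiveFrom 0)^[2 * α] V x +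
          (-bernsteinPart (2 * α - 1) V (Finset.Ico α (2 * α))).eval (x : ℂ)) := by
  obtain ⟨n, hn⟩ : ∃ n, 2 * α = n + 1 := ⟨2 * α - 1, by omega⟩
  have hn1 : 2 * α - 1 = n := by omega
  have hn0 : n ≠ 0 := by omega
  have hfac : (n.factorial : ℂ) ≠ 0 := by exact_mod_cast n.factorial_ne_zero
  have hsplit : ∫ y in (0 : ℝ)..1, ((max (x - y) 0 ^ n : ℝ) : ℂ) * V y =
      ∫ y in (0 : ℝ)..x, ((x : ℂ) - y) ^ n * V y := by
    have hc : Continuous fun y : ℝ => ((max (x - y) 0 ^ n : ℝ) : ℂ) * V y := by fun_prop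
    rw [← intervalIntegral.integral_add_adjacent_intervals (hc.intervalIntegrable 0 x)
      (hc.intervalIntegrable x 1)]
    have h2 : ∫ y in x..1, ((max (x - y) 0 ^ n : ℝ) : ℂ) * V y = 0 := by
      rw [← intervalIntegral.integral_zero (a := x) (b := 1) (E := ℂ) (μ := volume)]
      refine intervalIntegral.integral_congr fun y hy => ?_
      rw [uIcc_of_le hx.2] at hy
      simp [max_eq_right (sub_nonpos.2 hy.1), hn0]
    rw [h2, add_zero]
    refine intervalIntegral.integral_congr fun y hy => ?_
    rw [uIcc_of_le hx.1] at hy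
    simp [max_eq_left (sub_nonneg.2 hy.2)]
  rw [hn1, Polynomial.eval_neg, bernsteinPart_eval n hV, hn,
    primitiveFrom_iterate_succ_apply 0 x n hV, ← intervalIntegral.integral_const_mul,
    ← sub_eq_add_neg]
  have h3 : ∫ y in (0 : ℝ)..x, (n.factorial : ℂ) * (((x : ℂ) - y) ^ n / (n.factorial : ℂ) * V y) =
      ∫ y in (0 : ℝ)..x, ((x : ℂ) - y) ^ n * V y :=
    intervalIntegral.integral_congr fun y _ => by field_simp
  rw [h3, ← hsplit, ← intervalIntegral.integral_sub
    ((by fun_prop : Continuous _).intervalIntegrable _ _)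
    ((by fun_prop : Continuous _).intervalIntegrable _ _), ← intervalIntegral.integral_const_mul]
  refine intervalIntegral.integral_congr fun y _ => ?_
  simp only [greenKernel, hn1, ← hn]
  push_cast
  ring

/-- Passing from base point `0` to base point `1` replaces the terms divisible by `x^α` by the
complementary ones, which are divisible by `(1-x)^α`. -/
lemma primitiveFrom_zero_sub_bernsteinPart {α : ℕ} (hα : 1 ≤ α) {V : ℝ → ℂ} (hV : Continuous V)
    (x : ℝ) :
    ((2 * α - 1).factorial : ℂ) * (primitiveFrom 0)^[2 * α] V x +
        (-bernsteinPart (2 * α - 1) V (Finset.Ico α (2 * α))).eval (x : ℂ) =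
      ((2 * α - 1).factorial : ℂ) * (primitiveFrom 1)^[2 * α] V x +
        (bernsteinPart (2 * α - 1) V (Finset.range α)).eval (x : ℂ) := by
  obtain ⟨n, hn⟩ : ∃ n, 2 * α = n + 1 := ⟨2 * α - 1, by omega⟩
  have hn1 : 2 * α - 1 = n := by omega
  have hfac : (n.factorial : ℂ) ≠ 0 := by exact_mod_cast n.factorial_ne_zero
  have hsum : bernsteinPart n V (Finset.range α) + bernsteinPart n V (Finset.Ico α (2 * α)) =
      bernsteinPart n V (Finset.range (n + 1)) := by
    rw [← hn]
    exact Finset.sum_range_add_sum_Ico _ (by omega)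
  have hx := congrArg (Polynomial.eval (x : ℂ)) hsum
  rw [Polynomial.eval_add, bernsteinPart_range_eval n hV] at hx
  have key : ∀ a : ℝ, (n.factorial : ℂ) * (primitiveFrom a)^[2 * α] V x =
      ∫ y in a..x, ((x : ℂ) - y) ^ n * V y := by
    intro a
    rw [hn, primitiveFrom_iterate_succ_apply a x n hV, ← intervalIntegral.integral_const_mul]
    exact intervalIntegral.integral_congr fun y _ => by field_simp
  have hc : Continuous fun y : ℝ => ((x : ℂ) - y) ^ n * V y := by fun_prop
  rw [hn1, key, key, Polynomial.eval_neg, ← intervalIntegral.integral_add_adjacent_intervals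
    (hc.intervalIntegrable 0 1) (hc.intervalIntegrable 1 x), ← hx]
  ring

theorem isGreenKernel_greenKernel {α : ℕ} (hα : 1 ≤ α) : IsGreenKernel α (greenKernel α) := by
  refine ⟨(continuous_greenKernel α).continuousOn, fun v hv => ?_⟩
  set V : ℝ → ℂ := IccExtend zero_le_one ((Icc (0 : ℝ) 1).domRestrict v) with hVdef
  have hV : Continuous V := hv.domRestrict.Icc_extend'
  have hVv : ∀ x ∈ Icc (0 : ℝ) 1, V x = v x := fun x hx => by
    rw [hVdef, IccExtend_of_mem _ _ hx]; rfl
  set c : ℂ := (-1) ^ α / ((2 * α - 1).factorial : ℂ) with hc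
  set N : ℂ := ((2 * α - 1).factorial : ℂ) with hN
  have hN0 : N ≠ 0 := by rw [hN]; exact_mod_cast (2 * α - 1).factorial_ne_zero
  set p₀ := -bernsteinPart (2 * α - 1) V (Finset.Ico α (2 * α)) with hp₀
  set p₁ := bernsteinPart (2 * α - 1) V (Finset.range α) with hp₁
  have heq : EqOn (fun x => ∫ y in (0 : ℝ)..1, (greenKernel α x y : ℂ) * v y)
      (fun x : ℝ => c * N * (primitiveFrom 0)^[2 * α] V x +
        (Polynomial.C c * p₀).eval (x : ℂ)) (Icc 0 1) := by
    intro x hx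
    have h1 : ∫ y in (0 : ℝ)..1, (greenKernel α x y : ℂ) * v y =
        ∫ y in (0 : ℝ)..1, (greenKernel α x y : ℂ) * V y := by
      refine intervalIntegral.integral_congr fun y hy => ?_
      rw [uIcc_of_le zero_le_one] at hy
      simp only [hVv y hy]
    simp only
    rw [h1, integral_greenKernel hα hV hx, Polynomial.eval_mul, Polynomial.eval_C]
    ring
  -- the same function, written so that the boundary conditions at `1` are visible
  have hswap : (fun x : ℝ => c * N * (primitiveFrom 0)^[2 * α] V x +
        (Polynomial.C c * p₀).eval (x : ℂ)) = fun x : ℝ =>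
        c * N * (primitiveFrom 1)^[2 * α] V x + (Polynomial.C c * p₁).eval (x : ℂ) := by
    funext x
    have := primitiveFrom_zero_sub_bernsteinPart hα hV x
    rw [Polynomial.eval_mul, Polynomial.eval_mul, Polynomial.eval_C, mul_assoc, mul_assoc,
      ← mul_add, ← mul_add, this]
  have hF : ContDiff ℝ ((2 * α : ℕ) : WithTop ℕ∞)
      (fun x : ℝ => c * N * (primitiveFrom 0)^[2 * α] V x +
        (Polynomial.C c * p₀).eval (x : ℂ)) :=
    (contDiff_const.mul (contDiff_primitiveFrom_iterate hV 0 (2 * α))).add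
      (contDiff_polynomial_eval_ofReal _ _)
  refine ⟨hF.contDiffOn.congr heq, fun j hj => ⟨?_, ?_⟩, fun x hx => ?_⟩
  · rw [iteratedDerivWithin_Icc_eq hF heq (by omega : j ≤ 2 * α) (by simp),
      iteratedDeriv_primitiveFrom_add_polynomial hV 0 _ _ (by omega : j ≤ 2 * α)]
    simp only
    rw [primitiveFrom_iterate_base 0 V (by omega), mul_zero, zero_add, Complex.ofReal_zero]
    refine eval_iterate_derivative_eq_zero (m := α) (Dvd.dvd.mul_left ?_ _) hj
    rw [hp₀, dvd_neg]
    exact pow_dvd_bernsteinPart_zero _ _ fun k hk => (Finset.mem_Ico.1 hk).1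
  · rw [iteratedDerivWithin_Icc_eq hF heq (by omega : j ≤ 2 * α) (by simp), hswap,
      iteratedDeriv_primitiveFrom_add_polynomial hV 1 _ _ (by omega : j ≤ 2 * α)]
    simp only
    rw [primitiveFrom_iterate_base 1 V (by omega), mul_zero, zero_add, Complex.ofReal_one]
    refine eval_iterate_derivative_eq_zero (m := α) (Dvd.dvd.mul_left ?_ _) hj
    exact pow_dvd_bernsteinPart_one _ _ fun k hk => by
      have := Finset.mem_range.1 hk
      omega
  · rw [iteratedDerivWithin_Icc_eq hF heq le_rfl hx,
      iteratedDeriv_primitiveFrom_add_polynomial hV 0 _ _ le_rfl]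
    have hdeg : (Polynomial.C c * p₀).natDegree < 2 * α := by
      refine (Polynomial.natDegree_C_mul_le _ _).trans_lt ?_
      rw [hp₀, Polynomial.natDegree_neg]
      refine (natDegree_bernsteinPart_le _ _ fun k hk => ?_).trans_lt
        (by omega : 2 * α - 1 < 2 * α)
      have := Finset.mem_Ico.1 hk
      omega
    rw [Polynomial.iterate_derivative_eq_zero hdeg, ← hVv x hx]
    have h1 : ((-1 : ℂ) ^ α) * (-1) ^ α = 1 := by
      rw [← mul_pow]; simp
    simp only [Nat.sub_self, Function.iterate_zero, id, Polynomial.eval_zero, add_zero, hc]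
    rw [div_mul_cancel₀ _ hN0, ← mul_assoc, h1, one_mul]

/-! ### Integration by parts -/

lemma ContDiffOn.hasDerivWithinAt_iteratedDerivWithin {u : ℝ → ℂ} {m j : ℕ}
    (hu : ContDiffOn ℝ (m : WithTop ℕ∞) u (Icc 0 1)) (hj : j < m) {x : ℝ}
    (hx : x ∈ Icc (0 : ℝ) 1) :
    HasDerivWithinAt (iteratedDerivWithin j u (Icc 0 1))
      (iteratedDerivWithin (j + 1) u (Icc 0 1) x) (Icc 0 1) x := by
  rw [iteratedDerivWithin_succ]
  exact (hu.differentiableOn_iteratedDerivWithin (by exact_mod_cast hj)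
    (uniqueDiffOn_Icc one_pos) x hx).hasDerivWithinAt

lemma ContDiffOn.continuousOn_iteratedDerivWithin_Icc {u : ℝ → ℂ} {m j : ℕ}
    (hu : ContDiffOn ℝ (m : WithTop ℕ∞) u (Icc 0 1)) (hj : j ≤ m) :
    ContinuousOn (iteratedDerivWithin j u (Icc 0 1)) (Icc 0 1) :=
  hu.continuousOn_iteratedDerivWithin (by exact_mod_cast hj) (uniqueDiffOn_Icc one_pos)

/-- Moving `k` derivatives from `u` to `φ`; only the boundary conditions on `φ` are needed. -/
lemma integral_iteratedDerivWithin_mul_star {α : ℕ} {u φ : ℝ → ℂ}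
    (hu : ContDiffOn ℝ ((2 * α : ℕ) : WithTop ℕ∞) u (Icc 0 1))
    (hφ : ContDiffOn ℝ (α : WithTop ℕ∞) φ (Icc 0 1)) (hbc : DirichletBC α φ) {k : ℕ}
    (hk : k ≤ α) :
    ∫ x in (0 : ℝ)..1, iteratedDerivWithin (α + k) u (Icc 0 1) x *
        star (iteratedDerivWithin (α - k) φ (Icc 0 1) x) =
      (-1) ^ k * ∫ x in (0 : ℝ)..1, iteratedDerivWithin α u (Icc 0 1) x *
        star (iteratedDerivWithin α φ (Icc 0 1) x) := by
  induction k with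
  | zero => simp
  | succ k ih =>
    obtain ⟨j, hj⟩ : ∃ j, α - k = j + 1 := ⟨α - k - 1, by omega⟩
    have hj' : α - (k + 1) = j := by omega
    have hcont : ∀ {i m : ℕ} {f : ℝ → ℂ}, ContDiffOn ℝ (m : WithTop ℕ∞) f (Icc 0 1) → i ≤ m →
        IntervalIntegrable (iteratedDerivWithin i f (Icc 0 1)) volume 0 1 := fun hf hi =>
      ContinuousOn.intervalIntegrable (by
        rw [uIcc_of_le zero_le_one]; exact hf.continuousOn_iteratedDerivWithin_Icc hi)
    have hcont' : IntervalIntegrable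
        (fun x => star (iteratedDerivWithin (j + 1) φ (Icc 0 1) x)) volume 0 1 :=
      ContinuousOn.intervalIntegrable (by
        rw [uIcc_of_le zero_le_one]
        exact (hφ.continuousOn_iteratedDerivWithin_Icc (by omega : j + 1 ≤ α)).star)
    have h := intervalIntegral.integral_mul_deriv_eq_deriv_mul_of_hasDerivWithinAt
      (a := 0) (b := 1)
      (u := fun x => star (iteratedDerivWithin j φ (Icc 0 1) x))
      (u' := fun x => star (iteratedDerivWithin (j + 1) φ (Icc 0 1) x))
      (v := iteratedDerivWithin (α + k) u (Icc 0 1))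
      (v' := iteratedDerivWithin (α + k + 1) u (Icc 0 1))
      (fun x hx => by
        rw [uIcc_of_le zero_le_one] at hx ⊢
        exact (hφ.hasDerivWithinAt_iteratedDerivWithin (by omega) hx).star)
      (fun x hx => by
        rw [uIcc_of_le zero_le_one] at hx ⊢
        exact hu.hasDerivWithinAt_iteratedDerivWithin (by omega) hx)
      hcont' (hcont hu (by omega))
    simp only [(hbc j (by omega)).1, (hbc j (by omega)).2, star_zero, zero_mul, sub_zero,
      zero_sub] at h
    have ih' := ih (by omega)
    rw [hj] at ih'
    rw [hj', ← add_assoc]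
    calc _ = _ := by simp_rw [mul_comm]
      _ = _ := h
      _ = _ := by
        simp_rw [mul_comm (star _)]
        rw [ih']
        ring

/-- The weak form of the boundary value problem, `∫ v φ̄ = ∫ u^(α) conj(φ^(α))`. -/
lemma SolvesBVP.integral_mul_star {α : ℕ} {u v φ : ℝ → ℂ} (h : SolvesBVP α v u)
    (hφ : ContDiffOn ℝ (α : WithTop ℕ∞) φ (Icc 0 1)) (hbc : DirichletBC α φ) :
    ∫ x in (0 : ℝ)..1, v x * star (φ x) =
      ∫ x in (0 : ℝ)..1, iteratedDerivWithin α u (Icc 0 1) x *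
        star (iteratedDerivWithin α φ (Icc 0 1) x) := by
  have h1 := integral_iteratedDerivWithin_mul_star h.1 hφ hbc le_rfl
  rw [Nat.sub_self, iteratedDerivWithin_zero, ← two_mul] at h1
  have h2 : ∫ x in (0 : ℝ)..1, v x * star (φ x) =
      (-1) ^ α * ∫ x in (0 : ℝ)..1, iteratedDerivWithin (2 * α) u (Icc 0 1) x * star (φ x) := by
    rw [← intervalIntegral.integral_const_mul]
    refine intervalIntegral.integral_congr fun x hx => ?_
    rw [uIcc_of_le zero_le_one] at hx
    rw [← h.2.2 x hx, mul_assoc]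
  rw [h2, h1, ← mul_assoc, ← mul_pow]
  simp

lemma SolvesBVP.contDiffOn {α : ℕ} {u v : ℝ → ℂ} (h : SolvesBVP α v u) :
    ContDiffOn ℝ (α : WithTop ℕ∞) u (Icc 0 1) :=
  h.1.of_le (by exact_mod_cast (by omega : α ≤ 2 * α))

lemma SolvesBVP.congr_left {α : ℕ} {u v w : ℝ → ℂ} (h : SolvesBVP α v u)
    (huw : EqOn w u (Icc 0 1)) : SolvesBVP α v w :=
  ⟨h.1.congr huw, fun j hj => by
    rw [iteratedDerivWithin_congr huw (by simp), iteratedDerivWithin_congr huw (by simp)]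
    exact h.2.1 j hj, fun x hx => by rw [iteratedDerivWithin_congr huw hx]; exact h.2.2 x hx⟩

/-- The solution operator of the boundary value problem is symmetric. -/
lemma SolvesBVP.integral_symm {α : ℕ} {u v u' v' : ℝ → ℂ} (h : SolvesBVP α v u)
    (h' : SolvesBVP α v' u') :
    ∫ x in (0 : ℝ)..1, v x * star (u' x) = ∫ x in (0 : ℝ)..1, u x * star (v' x) := by
  rw [h.integral_mul_star h'.contDiffOn h'.2.1]
  have h2 := congrArg star (h'.integral_mul_star h.contDiffOn h.2.1)
  have hstar : ∀ f : ℝ → ℂ, star (∫ x in (0 : ℝ)..1, f x) = ∫ x in (0 : ℝ)..1, star (f x) := by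
    intro f
    simp only [intervalIntegral.integral_of_le zero_le_one]
    exact integral_conj.symm
  rw [hstar, hstar] at h2
  simp only [star_mul', star_star, mul_comm] at h2 ⊢
  rw [h2]

/-! ### Continuous functions in `L²(0,1)` -/

lemma ae_restrict_Ioo_of_forall_Icc {p : ℝ → Prop} (h : ∀ x ∈ Icc (0 : ℝ) 1, p x) :
    ∀ᵐ x ∂((volume : Measure ℝ).restrict (Ioo 0 1)), p x :=
  (ae_restrict_iff' measurableSet_Ioo).2 (ae_of_all _ fun x hx => h x (Ioo_subset_Icc_self hx))

lemma integral_eq_integral_Ioo {E : Type*} [NormedAddCommGroup E] [NormedSpace ℝ E] (f : ℝ → E) :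
    ∫ x in (0 : ℝ)..1, f x = ∫ x, f x ∂((volume : Measure ℝ).restrict (Ioo 0 1)) := by
  rw [intervalIntegral.integral_of_le zero_le_one, integral_Ioc_eq_integral_Ioo]

lemma memLp_of_continuousOn {f : ℝ → ℂ} (hf : ContinuousOn f (Icc 0 1)) :
    MemLp f 2 ((volume : Measure ℝ).restrict (Ioo 0 1)) := by
  obtain ⟨C, hC⟩ := isCompact_Icc.exists_bound_of_continuousOn hf
  exact MemLp.of_bound ((hf.mono Ioo_subset_Icc_self).aestronglyMeasurable measurableSet_Ioo) C
    (ae_restrict_Ioo_of_forall_Icc hC)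

/-- The class in `L²(0,1)` of a function that is continuous on `[0,1]`. -/
def toL2Unit (f : ℝ → ℂ) (hf : ContinuousOn f (Icc 0 1)) : L2Unit :=
  (memLp_of_continuousOn hf).toLp f

lemma coeFn_toL2Unit {f : ℝ → ℂ} (hf : ContinuousOn f (Icc 0 1)) :
    toL2Unit f hf =ᵐ[(volume : Measure ℝ).restrict (Ioo 0 1)] f :=
  MemLp.coeFn_toLp _

lemma inner_toL2Unit {f g : ℝ → ℂ} (hf : ContinuousOn f (Icc 0 1))
    (hg : ContinuousOn g (Icc 0 1)) :
    inner ℂ (toL2Unit f hf) (toL2Unit g hg) = ∫ x in (0 : ℝ)..1, g x * star (f x) := by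
  rw [L2.inner_def, integral_eq_integral_Ioo]
  refine integral_congr_ae ?_
  filter_upwards [coeFn_toL2Unit hf, coeFn_toL2Unit hg] with x h1 h2
  rw [h1, h2]
  rfl

lemma norm_toL2Unit_sq {f : ℝ → ℂ} (hf : ContinuousOn f (Icc 0 1)) :
    ‖toL2Unit f hf‖ ^ 2 = ∫ x in (0 : ℝ)..1, ‖f x‖ ^ 2 := by
  have h : ((‖toL2Unit f hf‖ ^ 2 : ℝ) : ℂ) = ((∫ x in (0 : ℝ)..1, ‖f x‖ ^ 2 : ℝ) : ℂ) := by
    rw [← intervalIntegral.integral_ofReal]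
    push_cast
    rw [← Complex.coe_algebraMap, ← inner_self_eq_norm_sq_to_K (𝕜 := ℂ), inner_toL2Unit]
    refine intervalIntegral.integral_congr fun x _ => ?_
    exact RCLike.mul_conj (f x)
  exact_mod_cast h

lemma toL2Unit_congr {f g : ℝ → ℂ} (hf : ContinuousOn f (Icc 0 1))
    (hg : ContinuousOn g (Icc 0 1)) (hfg : EqOn f g (Icc 0 1)) : toL2Unit f hf = toL2Unit g hg :=
  (MemLp.toLp_eq_toLp_iff _ _).2 (ae_restrict_Ioo_of_forall_Icc hfg)

/-- A continuous function that vanishes almost everywhere vanishes on `[0,1]`. -/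
lemma eqOn_zero_of_toL2Unit_eq_zero {f : ℝ → ℂ} (hf : ContinuousOn f (Icc 0 1))
    (h : toL2Unit f hf = 0) : ∀ x ∈ Icc (0 : ℝ) 1, f x = 0 := by
  have h0 : f =ᵐ[(volume : Measure ℝ).restrict (Icc 0 1)] 0 := by
    rw [← restrict_Ioo_eq_restrict_Icc]
    exact (coeFn_toL2Unit hf).symm.trans (by rw [h]; exact Lp.coeFn_zero ..)
  exact Measure.eqOn_Icc_of_ae_eq volume zero_ne_one h0 hf continuousOn_const

lemma dense_range_toL2Unit : Dense {w : L2Unit | ∃ f hf, w = toL2Unit f hf} := by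
  refine (BoundedContinuousFunction.toLp_denseRange ℂ
    ((volume : Measure ℝ).restrict (Ioo 0 1)) ℂ (p := 2) (by simp)).mono ?_
  rintro _ ⟨f, rfl⟩
  refine ⟨f, f.continuous.continuousOn, Lp.ext ?_⟩
  exact (BoundedContinuousFunction.coeFn_toLp 2 _ ℂ f).trans (coeFn_toL2Unit _).symm

/-! ### Integral operators with continuous kernel -/

section kernelMap

variable {X H : Type*} [TopologicalSpace X] [CompactSpace X] [NormedAddCommGroup H]
  [InnerProductSpace ℂ H]

/-- The map `v ↦ (x ↦ ⟪g x, v⟫)` attached to a continuous family `g` of vectors. -/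
def innerFamily (g : C(X, H)) : H →L[ℂ] BoundedContinuousFunction X ℂ :=
  LinearMap.mkContinuous
    { toFun := fun v => BoundedContinuousFunction.mkOfCompact
        ⟨fun x => inner ℂ (g x) v, by fun_prop⟩
      map_add' := fun v w => by ext x; simp
      map_smul' := fun c v => by ext x; simp }
    ‖g‖ fun v => by
      refine (BoundedContinuousFunction.norm_le (by positivity)).2 fun x => ?_
      exact (norm_inner_le_norm _ _).trans
        (mul_le_mul_of_nonneg_right (g.norm_coe_le_norm x) (norm_nonneg v))

/-- Compactness follows from the Arzelà–Ascoli theorem: the functions `⟪g ·, v⟫` with `‖v‖ < 1`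
inherit the modulus of continuity of `g`. -/
lemma isCompactOperator_innerFamily (g : C(X, H)) : IsCompactOperator (innerFamily g) := by
  refine (isCompactOperator_iff_isCompact_closure_image_ball
    (innerFamily g : H →ₗ[ℂ] BoundedContinuousFunction X ℂ) one_pos).2 ?_
  refine BoundedContinuousFunction.arzela_ascoli (Metric.closedBall 0 ‖g‖)
    (isCompact_closedBall _ _) _ ?_ ?_
  · rintro _ x ⟨v, hv, rfl⟩
    rw [mem_closedBall_zero_iff]
    rw [mem_ball_zero_iff] at hv
    refine ((innerFamily g v).norm_coe_le_norm x).trans ?_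
    have hle : ‖innerFamily g‖ ≤ ‖g‖ := LinearMap.mkContinuous_norm_le _ (norm_nonneg g) _
    exact ((innerFamily g).le_of_opNorm_le hle v).trans
      (mul_le_of_le_one_right (norm_nonneg g) hv.le)
  · intro x₀
    rw [Metric.equicontinuousAt_iff_right]
    intro ε hε
    filter_upwards [Metric.tendsto_nhds.1 (g.continuous.tendsto x₀) ε hε] with x hx
    rintro ⟨_, v, hv, rfl⟩
    rw [mem_ball_zero_iff] at hv
    change dist (inner ℂ (g x₀) v) (inner ℂ (g x) v) < ε
    rw [dist_eq_norm, ← inner_sub_left]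
    refine (norm_inner_le_norm _ _).trans_lt ?_
    rw [dist_comm, dist_eq_norm] at hx
    exact (mul_le_of_le_one_right (norm_nonneg _) hv.le).trans_lt hx

end kernelMap

/-- Constant extension of continuous functions from `[0,1]` to `ℝ`. -/
def extendIcc : BoundedContinuousFunction (Icc (0 : ℝ) 1) ℂ →L[ℂ] BoundedContinuousFunction ℝ ℂ :=
  LinearMap.mkContinuous
    { toFun := fun f => f.compContinuous ⟨projIcc (0 : ℝ) 1 zero_le_one, continuous_projIcc⟩
      map_add' := fun f g => by ext x; simp
      map_smul' := fun c f => by ext x; simp }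
    1 fun f => by
      rw [one_mul]
      exact (BoundedContinuousFunction.norm_le (norm_nonneg f)).2 fun x => f.norm_coe_le_norm _

/-- The embedding of `C[0,1]` into `L²(0,1)`. -/
def embedIcc : BoundedContinuousFunction (Icc (0 : ℝ) 1) ℂ →L[ℂ] L2Unit :=
  (BoundedContinuousFunction.toLp 2 ((volume : Measure ℝ).restrict (Ioo 0 1)) ℂ).comp extendIcc

lemma coeFn_embedIcc (f : BoundedContinuousFunction (Icc (0 : ℝ) 1) ℂ) :
    embedIcc f =ᵐ[(volume : Measure ℝ).restrict (Ioo 0 1)]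
      fun x => f (projIcc 0 1 zero_le_one x) :=
  BoundedContinuousFunction.coeFn_toLp 2 _ ℂ (extendIcc f)

/-- A kernel that is continuous on `[0,1]²` defines a compact operator on `L²(0,1)`. -/
theorem exists_isIntegralOperator {G : ℝ → ℝ → ℝ}
    (hG : ContinuousOn (fun p : ℝ × ℝ => G p.1 p.2) (Icc 0 1 ×ˢ Icc 0 1)) :
    ∃ K : L2Unit →L[ℂ] L2Unit, IsIntegralOperator G K ∧ IsCompactOperator K := by
  have hc : Continuous fun p : Icc (0 : ℝ) 1 × Icc (0 : ℝ) 1 => (G p.1 p.2 : ℂ) :=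
    Complex.continuous_ofReal.comp (hG.comp_continuous
      (f := fun p : Icc (0 : ℝ) 1 × Icc (0 : ℝ) 1 => ((p.1 : ℝ), (p.2 : ℝ)))
      (by fun_prop) fun p => ⟨p.1.2, p.2.2⟩)
  let g₀ : C(Icc (0 : ℝ) 1, C(Icc (0 : ℝ) 1, ℂ)) := ContinuousMap.curry ⟨_, hc⟩
  let g : C(Icc (0 : ℝ) 1, L2Unit) :=
    ⟨fun x => embedIcc (BoundedContinuousFunction.mkOfCompact (g₀ x)), by
      refine embedIcc.continuous.comp ?_
      exact (ContinuousMap.linearIsometryBoundedOfCompact (Icc (0 : ℝ) 1) ℂ ℂ).continuous.comp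
        g₀.continuous⟩
  refine ⟨embedIcc.comp (innerFamily g), fun v => ?_,
    (isCompactOperator_innerFamily g).clm_comp embedIcc⟩
  refine (coeFn_embedIcc _).trans ?_
  refine ae_restrict_Ioo_of_forall_Icc fun x hx => ?_
  change inner ℂ (g (projIcc 0 1 zero_le_one x)) v = ∫ y in (0 : ℝ)..1, (G x y : ℂ) * v y
  rw [projIcc_of_mem _ hx, L2.inner_def, integral_eq_integral_Ioo]
  refine integral_congr_ae ?_
  have h1 : ∀ᵐ y ∂((volume : Measure ℝ).restrict (Ioo 0 1)), y ∈ Icc (0 : ℝ) 1 :=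
    ae_restrict_Ioo_of_forall_Icc fun y hy => hy
  filter_upwards [coeFn_embedIcc (BoundedContinuousFunction.mkOfCompact (g₀ ⟨x, hx⟩)), h1]
    with y hy hy1
  simp only [g, ContinuousMap.coe_mk]
  rw [hy, projIcc_of_mem _ hy1]
  change v y * star ((G x y : ℝ) : ℂ) = _
  rw [mul_comm]
  congr 1
  exact Complex.conj_ofReal _

lemma IsIntegralOperator.unique {G : ℝ → ℝ → ℝ} {K K' : L2Unit →L[ℂ] L2Unit}
    (h : IsIntegralOperator G K) (h' : IsIntegralOperator G K') : K = K' :=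
  ContinuousLinearMap.ext fun v => Lp.ext <| by
    filter_upwards [h v, h' v] with x h1 h2
    rw [h1, h2]

lemma IsIntegralOperator.isCompactOperator {G : ℝ → ℝ → ℝ} {K : L2Unit →L[ℂ] L2Unit}
    (hG : ContinuousOn (fun p : ℝ × ℝ => G p.1 p.2) (Icc 0 1 ×ˢ Icc 0 1))
    (h : IsIntegralOperator G K) : IsCompactOperator K := by
  obtain ⟨K', hK', hc⟩ := exists_isIntegralOperator hG
  rwa [h.unique hK']

/-- Integrals against an `L²` function only see its class. -/
lemma integral_kernel_mul_congr {g : ℝ → ℂ} {f f' : ℝ → ℂ}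
    (h : f =ᵐ[(volume : Measure ℝ).restrict (Ioo 0 1)] f') :
    ∫ y in (0 : ℝ)..1, g y * f y = ∫ y in (0 : ℝ)..1, g y * f' y := by
  rw [integral_eq_integral_Ioo, integral_eq_integral_Ioo]
  refine integral_congr_ae ?_
  filter_upwards [h] with y hy
  rw [hy]

/-- The range of an integral operator with continuous kernel consists of continuous functions. -/
lemma continuousOn_integral_kernel {G : ℝ → ℝ → ℝ}
    (hG : ContinuousOn (fun p : ℝ × ℝ => G p.1 p.2) (Icc 0 1 ×ˢ Icc 0 1)) (v : L2Unit) :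
    ContinuousOn (fun x => ∫ y in (0 : ℝ)..1, (G x y : ℂ) * v y) (Icc 0 1) := by
  obtain ⟨C, hC⟩ := (isCompact_Icc.prod isCompact_Icc).exists_bound_of_continuousOn hG
  have hv : Integrable v ((volume : Measure ℝ).restrict (Ioo 0 1)) :=
    (Lp.memLp v).integrable (by norm_num)
  simp only [integral_eq_integral_Ioo]
  refine continuousOn_of_dominated (bound := fun y => C * ‖v y‖) (fun x hx => ?_) (fun x hx => ?_)
    (hv.norm.const_mul C) ?_
  · refine AEStronglyMeasurable.mul ?_ hv.1
    refine ContinuousOn.aestronglyMeasurable ?_ measurableSet_Ioo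
    exact Complex.continuous_ofReal.comp_continuousOn (hG.comp (f := fun y => (x, y))
      (by fun_prop) fun y hy => ⟨hx, Ioo_subset_Icc_self hy⟩)
  · refine ae_restrict_Ioo_of_forall_Icc fun y hy => ?_
    rw [norm_mul, Complex.norm_real]
    exact mul_le_mul_of_nonneg_right (hC (x, y) ⟨hx, hy⟩) (norm_nonneg _)
  · refine ae_restrict_Ioo_of_forall_Icc fun y hy => ContinuousOn.mul ?_ continuousOn_const
    exact Complex.continuous_ofReal.comp_continuousOn (hG.comp (f := fun x => (x, y))
      (by fun_prop) fun x hx => ⟨hx, hy⟩)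

/-! ### The Green operator -/

/-- On continuous functions the Green operator is the classical solution operator. -/
lemma IsIntegralOperator.apply_toL2Unit {α : ℕ} {G : ℝ → ℝ → ℝ} {K : L2Unit →L[ℂ] L2Unit}
    (hG : IsGreenKernel α G) (hK : IsIntegralOperator G K) {v : ℝ → ℂ}
    (hv : ContinuousOn v (Icc 0 1)) :
    ∃ u, ∃ h : SolvesBVP α v u, K (toL2Unit v hv) = toL2Unit u h.1.continuousOn := by
  refine ⟨_, hG.2 v hv, Lp.ext ?_⟩
  filter_upwards [hK (toL2Unit v hv), coeFn_toL2Unit (hG.2 v hv).1.continuousOn] with x h1 h2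
  rw [h1, h2]
  exact integral_kernel_mul_congr (coeFn_toL2Unit hv)

/-- Solutions of the boundary value problem are unique, because the solution operator is symmetric
and maps onto test functions. -/
lemma SolvesBVP.eqOn {α : ℕ} {G : ℝ → ℝ → ℝ} (hG : IsGreenKernel α G) {v u u' : ℝ → ℂ}
    (h : SolvesBVP α v u) (h' : SolvesBVP α v u') : EqOn u u' (Icc 0 1) := by
  have hd : ContinuousOn (fun x => u x - u' x) (Icc 0 1) := h.1.continuousOn.sub h'.1.continuousOn
  -- the solution with right-hand side `u - u'` serves as test function
  have hw := hG.2 _ hd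
  have hint : ∀ {f g : ℝ → ℂ}, ContinuousOn f (Icc 0 1) → ContinuousOn g (Icc 0 1) →
      IntervalIntegrable (fun x => f x * star (g x)) volume 0 1 := fun hf hg =>
    ContinuousOn.intervalIntegrable (by rw [uIcc_of_le zero_le_one]; exact hf.mul hg.star)
  have h1 := h.integral_symm hw
  have h2 := h'.integral_symm hw
  have h3 : ∫ x in (0 : ℝ)..1, (u x - u' x) * star (u x - u' x) = 0 := by
    simp only [sub_mul]
    rw [intervalIntegral.integral_sub (hint h.1.continuousOn hd) (hint h'.1.continuousOn hd),
      ← h1, ← h2, sub_self]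
  rw [← inner_toL2Unit hd hd, inner_self_eq_zero] at h3
  intro x hx
  exact sub_eq_zero.1 (eqOn_zero_of_toL2Unit_eq_zero hd h3 x hx)

theorem IsGreenOperator.unique {α : ℕ} {K K' : L2Unit →L[ℂ] L2Unit} (h : IsGreenOperator α K)
    (h' : IsGreenOperator α K') : K = K' := by
  obtain ⟨G, hG, hK⟩ := h
  obtain ⟨G', hG', hK'⟩ := h'
  refine ContinuousLinearMap.coeFn_injective
    (K.continuous.ext_on dense_range_toL2Unit K'.continuous ?_)
  rintro _ ⟨v, hv, rfl⟩
  obtain ⟨u, hu, h1⟩ := hK.apply_toL2Unit hG hv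
  obtain ⟨u', hu', h2⟩ := hK'.apply_toL2Unit hG' hv
  rw [h1, h2]
  exact toL2Unit_congr _ _ (hu.eqOn hG hu')

theorem isSelfAdjoint_greenOperator {α : ℕ} {G : ℝ → ℝ → ℝ} {K : L2Unit →L[ℂ] L2Unit}
    (hG : IsGreenKernel α G) (hK : IsIntegralOperator G K) : IsSelfAdjoint K := by
  rw [ContinuousLinearMap.isSelfAdjoint_iff_isSymmetric]
  have key : ∀ v ∈ {w : L2Unit | ∃ f hf, w = toL2Unit f hf},
      ∀ w ∈ {w : L2Unit | ∃ f hf, w = toL2Unit f hf}, inner ℂ (K v) w = inner ℂ v (K w) := by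
    rintro _ ⟨f, hf, rfl⟩ _ ⟨g, hg, rfl⟩
    obtain ⟨u, hu, h1⟩ := hK.apply_toL2Unit hG hf
    obtain ⟨u', hu', h2⟩ := hK.apply_toL2Unit hG hg
    rw [h1, h2, inner_toL2Unit, inner_toL2Unit]
    exact hu'.integral_symm hu
  have key2 : ∀ v ∈ {w : L2Unit | ∃ f hf, w = toL2Unit f hf}, ∀ w : L2Unit,
      inner ℂ (K v) w = inner ℂ v (K w) := fun v hv => by
    refine congrFun (Continuous.ext_on dense_range_toL2Unit ?_ ?_ (key v hv)) <;> fun_prop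
  intro v w
  revert v
  refine congrFun (Continuous.ext_on dense_range_toL2Unit
    (f := fun v => inner ℂ (K v) w) (g := fun v => inner ℂ v (K w)) ?_ ?_
    fun v hv => key2 v hv w) <;> fun_prop

/-- A nonzero eigenvalue of the Green operator is the reciprocal of an eigenvalue of the boundary
value problem: an eigenvector has a continuous representative, to which the classical solution
property applies. -/
lemma mem_dirichletEigenvalues_of_hasEigenvector {α : ℕ} {G : ℝ → ℝ → ℝ}
    {K : L2Unit →L[ℂ] L2Unit} (hG : IsGreenKernel α G) (hK : IsIntegralOperator G K) {μ : ℝ}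
    (hμ : μ ≠ 0) {f : L2Unit} (hf : f ≠ 0) (hKf : K f = (μ : ℂ) • f) :
    1 / μ ∈ dirichletEigenvalues α := by
  have hμ' : (μ : ℂ) ≠ 0 := by exact_mod_cast hμ
  set u : ℝ → ℂ := fun x => ∫ y in (0 : ℝ)..1, (G x y : ℂ) * f y with hu
  have huc : ContinuousOn u (Icc 0 1) := continuousOn_integral_kernel hG.1 f
  have hKu : K f = toL2Unit u huc := Lp.ext <| by
    filter_upwards [hK f, coeFn_toL2Unit huc] with x h1 h2
    rw [h1, h2]
  have hfu : f = ((1 / μ : ℝ) : ℂ) • toL2Unit u huc := by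
    rw [← hKu, hKf, smul_smul]
    push_cast
    rw [one_div_mul_cancel hμ', one_smul]
  have hfae : f =ᵐ[(volume : Measure ℝ).restrict (Ioo 0 1)] fun y => ((1 / μ : ℝ) : ℂ) * u y := by
    have h1 := Lp.coeFn_smul ((1 / μ : ℝ) : ℂ) (toL2Unit u huc)
    rw [← hfu] at h1
    filter_upwards [h1, coeFn_toL2Unit huc] with y h2 h3
    rw [h2, Pi.smul_apply, h3, smul_eq_mul]
  refine ⟨u, ?_, ?_⟩
  · refine (hG.2 (fun y => ((1 / μ : ℝ) : ℂ) * u y) (continuousOn_const.mul huc)).congr_left ?_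
    exact fun x _ => integral_kernel_mul_congr hfae
  · by_contra! h
    refine hf ?_
    rw [hfu, toL2Unit_congr huc continuousOn_const (g := fun _ => 0) h, toL2Unit]
    exact smul_eq_zero_of_right _ (MemLp.toLp_zero _)

/-- The energy identity for an eigenfunction. -/
lemma energy_eq_of_eigenfunction {α : ℕ} {l : ℝ} {u : ℝ → ℂ}
    (h : SolvesBVP α (fun x => (l : ℂ) * u x) u) :
    ∫ x in (0 : ℝ)..1, ‖iteratedDerivWithin α u (Icc 0 1) x‖ ^ 2 =
      l * ∫ x in (0 : ℝ)..1, ‖u x‖ ^ 2 := by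
  have h1 := h.integral_mul_star h.contDiffOn h.2.1
  have hsq : ∀ z : ℂ, z * star z = ((‖z‖ ^ 2 : ℝ) : ℂ) := fun z => by
    push_cast; exact RCLike.mul_conj z
  simp only [mul_assoc, hsq, intervalIntegral.integral_const_mul] at h1
  rw [intervalIntegral.integral_ofReal, intervalIntegral.integral_ofReal] at h1
  exact_mod_cast h1.symm

lemma integral_norm_sq_pos {f : ℝ → ℂ} (hf : ContinuousOn f (Icc 0 1))
    (h : ∃ x ∈ Icc (0 : ℝ) 1, f x ≠ 0) : 0 < ∫ x in (0 : ℝ)..1, ‖f x‖ ^ 2 := by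
  rw [← norm_toL2Unit_sq hf]
  obtain ⟨x, hx, hne⟩ := h
  have : toL2Unit f hf ≠ 0 := fun h0 => hne (eqOn_zero_of_toL2Unit_eq_zero hf h0 x hx)
  positivity

/-- The Wirtinger–Sobolev inequality with the norm of the Green operator as its constant. With
`w = K u` one has `‖u‖² = ⟪w^(α), u^(α)⟫` and `‖w^(α)‖² = ⟪K u, u⟫ ≤ ‖K‖ ‖u‖²`. -/
theorem norm_mem_wirtingerSobolevConstants {α : ℕ} {G : ℝ → ℝ → ℝ}
    {K : L2Unit →L[ℂ] L2Unit} (hG : IsGreenKernel α G) (hK : IsIntegralOperator G K) :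
    ‖K‖ ∈ wirtingerSobolevConstants α := by
  intro u hu hbc
  obtain ⟨w, hw, hKu⟩ := hK.apply_toL2Unit hG hu.continuousOn
  have hua := hu.continuousOn_iteratedDerivWithin_Icc (le_refl α)
  have hwa := hw.contDiffOn.continuousOn_iteratedDerivWithin_Icc (le_refl α)
  rw [← norm_toL2Unit_sq hu.continuousOn, ← norm_toL2Unit_sq hua]
  set a := toL2Unit u hu.continuousOn
  set b := toL2Unit _ hua
  set d := toL2Unit _ hwa
  have h1 : inner ℂ a a = inner ℂ b d := by
    rw [inner_toL2Unit, inner_toL2Unit]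
    exact hw.integral_mul_star hu hbc
  have h2 : inner ℂ (K a) a = inner ℂ d d := by
    rw [hKu, inner_toL2Unit, inner_toL2Unit]
    exact hw.integral_mul_star hw.contDiffOn hw.2.1
  have h3 : ‖a‖ ^ 2 ≤ ‖b‖ * ‖d‖ := by
    have h := norm_inner_le_norm (𝕜 := ℂ) b d
    rw [← h1, inner_self_eq_norm_sq_to_K] at h
    simpa using h
  have h4 : ‖d‖ ^ 2 ≤ ‖K‖ * ‖a‖ ^ 2 := by
    have h := norm_inner_le_norm (𝕜 := ℂ) (K a) a
    rw [h2, inner_self_eq_norm_sq_to_K] at h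
    have h5 : ‖d‖ ^ 2 ≤ ‖K a‖ * ‖a‖ := by simpa using h
    have h6 := mul_le_mul_of_nonneg_right (K.le_opNorm a) (norm_nonneg a)
    nlinarith
  rcases eq_or_ne a 0 with ha | ha
  · rw [ha, norm_zero, zero_pow two_ne_zero]
    positivity
  · have hpos : 0 < ‖a‖ ^ 2 := by positivity
    have h7 : (‖a‖ ^ 2) ^ 2 ≤ (‖b‖ * ‖d‖) ^ 2 := by gcongr
    have h8 : (‖b‖ * ‖d‖) ^ 2 ≤ ‖b‖ ^ 2 * (‖K‖ * ‖a‖ ^ 2) := by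
      rw [mul_pow]; gcongr
    refine le_of_mul_le_mul_right ?_ hpos
    nlinarith

/-- Every eigenvalue of the boundary value problem is at least the reciprocal of every
Wirtinger–Sobolev constant. -/
lemma one_div_le_of_mem_dirichletEigenvalues {α : ℕ} {C l : ℝ} (hC : 0 < C)
    (hW : C ∈ wirtingerSobolevConstants α) (hl : l ∈ dirichletEigenvalues α) : 1 / C ≤ l := by
  obtain ⟨u, hu, hne⟩ := hl
  have h1 := hW u hu.contDiffOn hu.2.1
  have hpos := integral_norm_sq_pos hu.1.continuousOn hne
  rw [energy_eq_of_eigenfunction hu, ← mul_assoc] at h1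
  rw [div_le_iff₀' hC]
  by_contra! h
  nlinarith

/-- The operator norm of a compact self-adjoint operator is, up to sign, an eigenvalue; a negative
eigenvalue is excluded by the energy identity. -/
theorem one_div_norm_mem_dirichletEigenvalues {α : ℕ} {G : ℝ → ℝ → ℝ}
    {K : L2Unit →L[ℂ] L2Unit} (hG : IsGreenKernel α G) (hK : IsIntegralOperator G K)
    (hpos : 0 < ‖K‖) : 1 / ‖K‖ ∈ dirichletEigenvalues α := by
  have hsa := isSelfAdjoint_greenOperator hG hK
  have hcomp := hK.isCompactOperator hG.1
  have : Nontrivial L2Unit := by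
    by_contra h
    rw [not_nontrivial_iff_subsingleton] at h
    refine hpos.ne' ?_
    rw [show K = 0 from ContinuousLinearMap.ext fun _ => Subsingleton.elim _ _, norm_zero]
  have hspec : algebraMap ℝ ℂ ‖K‖ ∈ spectrum ℂ K ∨ algebraMap ℝ ℂ (-‖K‖) ∈ spectrum ℂ K := by
    simp_rw [spectrum, Set.mem_compl_iff, map_neg]
    by_contra! h
    obtain ⟨c, hc0, hc⟩ := K.abs_rayleighQuotient_le_of_norm_mem_resolventSet h.1 h.2
    have h1 := ciSup_le hc
    rw [← K.norm_eq_iSup_rayleighQuotient hsa.isSymmetric] at h1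
    linarith
  have heig : ∀ μ : ℝ, μ ≠ 0 → algebraMap ℝ ℂ μ ∈ spectrum ℂ K →
      1 / μ ∈ dirichletEigenvalues α := by
    intro μ hμ hmem
    have hμ' : algebraMap ℝ ℂ μ ≠ 0 := by simpa using hμ
    obtain ⟨f, hf⟩ := ((hcomp.hasEigenvalue_iff_mem_spectrum hμ').2 hmem).exists_hasEigenvector
    exact mem_dirichletEigenvalues_of_hasEigenvector hG hK hμ hf.2 hf.apply_eq_smul
  rcases hspec with h | h
  · exact heig _ hpos.ne' h
  · have h1 := one_div_le_of_mem_dirichletEigenvalues hpos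
      (norm_mem_wirtingerSobolevConstants hG hK) (heig _ (neg_ne_zero.2 hpos.ne') h)
    have h2 : 1 / (-‖K‖) < 0 := one_div_neg.2 (neg_neg_of_pos hpos)
    have h3 : 0 < 1 / ‖K‖ := by positivity
    linarith

/-! ### The kernel bound `|G(x,y)|² ≤ G(x,x) G(y,y)` and the trace -/

/-- Differentiating a partial sum of the binomial expansion of `(p - q)^n` along `p - q = const`
telescopes. -/
lemma hasDerivAt_partial_binomial (n : ℕ) (d q : ℝ) {m : ℕ} (hm : m < n) :
    HasDerivAt (fun q : ℝ => ∑ k ∈ Finset.range (m + 1),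
        (n.choose k : ℝ) * (q + d) ^ k * (-q) ^ (n - k))
      (-((n.choose m * (n - m) : ℕ) : ℝ) * (q + d) ^ m * (-q) ^ (n - m - 1)) q := by
  have hp : ∀ k : ℕ, HasDerivAt (fun q : ℝ => (q + d) ^ k) (k * (q + d) ^ (k - 1)) q := by
    intro k
    exact (((hasDerivAt_id q).add_const d).pow k).congr_deriv (by simp)
  have hq : ∀ k : ℕ, HasDerivAt (fun q : ℝ => (-q) ^ k) (-(k * (-q) ^ (k - 1))) q := by
    intro k
    exact ((hasDerivAt_id q).neg.pow k).congr_deriv (by simp)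
  induction m with
  | zero =>
    have h := hq n
    simp only [zero_add, Finset.range_one, Finset.sum_singleton, Nat.choose_zero_right,
      Nat.cast_one, pow_zero, mul_one, one_mul, Nat.sub_zero]
    exact h.congr_deriv (by ring)
  | succ m ih =>
    have h1 := ih (by omega)
    have h2 := (((hp (m + 1)).const_mul (n.choose (m + 1) : ℝ)).mul (hq (n - (m + 1))))
    have h3 : ((n.choose (m + 1) : ℝ)) * ((m : ℝ) + 1) = ((n.choose m * (n - m) : ℕ) : ℝ) := by
      exact_mod_cast Nat.choose_succ_right_eq n m
    simp only [Finset.sum_range_succ _ (m + 1)]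
    refine (h1.add h2).congr_deriv ?_
    rw [← h3, Nat.add_sub_cancel, Nat.sub_sub n m 1]
    push_cast
    ring

/-- The value `G(x,y)` for `y ≤ x`, as a function of `p = x(1-y)` and `q = y(1-x)`; here
`α = m + 1`. -/
def greenProfile (m : ℕ) (p q : ℝ) : ℝ :=
  (-1) ^ (m + 1) / ((2 * m + 1).factorial : ℝ) *
    ∑ k ∈ Finset.range (m + 1), ((2 * m + 1).choose k : ℝ) * p ^ k * (-q) ^ (2 * m + 1 - k)

lemma hasDerivAt_greenProfile (m : ℕ) (d q : ℝ) :
    HasDerivAt (fun q => greenProfile m (q + d) q)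
      (((q + d) * q) ^ m / (m.factorial : ℝ) ^ 2) q := by
  refine ((hasDerivAt_partial_binomial (2 * m + 1) d q (by omega : m < 2 * m + 1)).const_mul
    _).congr_deriv ?_
  have h1 : 2 * m + 1 - m = m + 1 := by omega
  have h2 : ((2 * m + 1).choose m * (m + 1) : ℕ) * (m.factorial * m.factorial) =
      (2 * m + 1).factorial := by
    have := Nat.choose_mul_factorial_mul_factorial (by omega : m ≤ 2 * m + 1)
    rw [h1, Nat.factorial_succ] at this
    rw [← this]
    ring
  have h3 : (((2 * m + 1).choose m * (m + 1) : ℕ) : ℝ) * ((m.factorial : ℝ) * m.factorial) =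
      ((2 * m + 1).factorial : ℝ) := by exact_mod_cast h2
  have h4 : (m.factorial : ℝ) ≠ 0 := by exact_mod_cast m.factorial_ne_zero
  have h5 : (((2 * m + 1).choose m * (m + 1) : ℕ) : ℝ) ≠ 0 := by
    have := Nat.choose_pos (by omega : m ≤ 2 * m + 1)
    positivity
  have h6 : ((-1 : ℝ) ^ m) * (-1) ^ m = 1 := by rw [← mul_pow]; simp
  rw [h1, Nat.add_sub_cancel, ← h3, neg_pow q m, mul_pow, pow_succ]
  field_simp
  linear_combination ((q + d) ^ m * q ^ m) * h6

lemma greenProfile_zero (m : ℕ) (p : ℝ) : greenProfile m p 0 = 0 := by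
  unfold greenProfile
  rw [Finset.sum_eq_zero, mul_zero]
  intro k hk
  have := Finset.mem_range.1 hk
  rw [neg_zero, zero_pow (by omega), mul_zero]

lemma continuous_greenProfile (m : ℕ) (d : ℝ) :
    Continuous fun q => greenProfile m (q + d) q := by
  unfold greenProfile
  fun_prop

lemma greenProfile_nonneg (m : ℕ) {d q : ℝ} (hd : 0 ≤ d) (hq : 0 ≤ q) :
    0 ≤ greenProfile m (q + d) q := by
  have hmono : MonotoneOn (fun q => greenProfile m (q + d) q) (Ici 0) := by
    refine monotoneOn_of_hasDerivWithinAt_nonneg (convex_Ici 0)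
      (continuous_greenProfile m d).continuousOn
      (fun x _ => (hasDerivAt_greenProfile m d x).hasDerivWithinAt) fun x hx => ?_
    rw [interior_Ici] at hx
    have : 0 < x := hx
    positivity
  have := hmono (mem_Ici.2 le_rfl) (mem_Ici.2 hq) hq
  simpa [greenProfile_zero] using this

/-- Along `p - q = d`, the derivative of `√(pq)` is at least `1` by the arithmetic–geometric mean
inequality, so the right-hand side grows at least as fast as the profile. -/
lemma greenProfile_le (m : ℕ) {d q : ℝ} (hd : 0 ≤ d) (hq : 0 ≤ q) :
    greenProfile m (q + d) q ≤
      Real.sqrt ((q + d) * q) ^ (2 * m + 1) / ((2 * m + 1) * (m.factorial : ℝ) ^ 2) := by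
  have hf : (0 : ℝ) < m.factorial := by exact_mod_cast m.factorial_pos
  have hmono : MonotoneOn (fun q => Real.sqrt ((q + d) * q) ^ (2 * m + 1) /
      ((2 * m + 1) * (m.factorial : ℝ) ^ 2) - greenProfile m (q + d) q) (Ici 0) := by
    refine monotoneOn_of_hasDerivWithinAt_nonneg (f' := fun x =>
      ((2 * m + 1 : ℕ) * Real.sqrt ((x + d) * x) ^ (2 * m) *
        ((1 * x + (x + d) * 1) / (2 * Real.sqrt ((x + d) * x)))) /
      ((2 * m + 1) * (m.factorial : ℝ) ^ 2) - ((x + d) * x) ^ m / (m.factorial : ℝ) ^ 2)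
      (convex_Ici 0) ?_ (fun x hx => ?_) fun x hx => ?_
    · exact (Continuous.sub (by fun_prop) (continuous_greenProfile m d)).continuousOn
    · rw [interior_Ici] at hx
      have hx : 0 < x := hx
      have h1 := (((hasDerivAt_id x).add_const d).mul (hasDerivAt_id x)).sqrt
        (by simp only [Pi.mul_apply, id]; positivity)
      have h2 := ((h1.pow (2 * m + 1)).div_const ((2 * m + 1) * (m.factorial : ℝ) ^ 2)).sub
        (hasDerivAt_greenProfile m d x)
      exact h2.hasDerivWithinAt
    · rw [interior_Ici] at hx
      have hx : 0 < x := hx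
      have hs : 0 < Real.sqrt ((x + d) * x) := Real.sqrt_pos.2 (by positivity)
      have hsq : Real.sqrt ((x + d) * x) ^ 2 = (x + d) * x := Real.sq_sqrt (by positivity)
      have h1 : 1 ≤ (1 * x + (x + d) * 1) / (2 * Real.sqrt ((x + d) * x)) := by
        rw [le_div_iff₀ (by positivity), one_mul]
        refine abs_le_of_sq_le_sq' ?_ (by positivity) |>.2
        rw [mul_pow, hsq]
        nlinarith [sq_nonneg d]
      have hpow : ((x + d) * x) ^ m = Real.sqrt ((x + d) * x) ^ (2 * m) := by rw [pow_mul, hsq]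
      rw [sub_nonneg, hpow, div_le_div_iff₀ (by positivity) (by positivity)]
      push_cast
      have h2 : 0 ≤ Real.sqrt ((x + d) * x) ^ (2 * m) * ((2 * m + 1) * (m.factorial : ℝ) ^ 2) := by
        positivity
      have h3 := mul_le_mul_of_nonneg_left h1 h2
      linarith
  have := hmono (mem_Ici.2 le_rfl) (mem_Ici.2 hq) hq
  simp only [greenProfile_zero, mul_zero, Real.sqrt_zero, sub_zero] at this
  rw [zero_pow (by omega), zero_div] at this
  linarith

lemma greenKernel_of_le (m : ℕ) {x y : ℝ} (h : y ≤ x) :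
    greenKernel (m + 1) x y = greenProfile m (x * (1 - y)) (y * (1 - x)) := by
  have h1 : 2 * (m + 1) - 1 = 2 * m + 1 := by omega
  have h2 : 2 * (m + 1) = 2 * m + 1 + 1 := by omega
  have h3 : x - y = x * (1 - y) + -(y * (1 - x)) := by ring
  have h4 : (x - y) ^ (2 * m + 1) = ∑ k ∈ Finset.range (2 * m + 1 + 1),
      ((2 * m + 1).choose k : ℝ) * (x * (1 - y)) ^ k * (-(y * (1 - x))) ^ (2 * m + 1 - k) := by
    rw [h3, add_pow]
    exact Finset.sum_congr rfl fun k _ => by ring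
  rw [greenKernel, greenProfile, h1, h2, max_eq_left (sub_nonneg.2 h), h4,
    ← Finset.sum_range_add_sum_Ico _ (by omega : m + 1 ≤ 2 * m + 1 + 1), add_sub_cancel_right]

lemma greenKernel_of_ge (m : ℕ) {x y : ℝ} (h : x ≤ y) :
    greenKernel (m + 1) x y = greenProfile m (y * (1 - x)) (x * (1 - y)) := by
  have h1 : 2 * (m + 1) - 1 = 2 * m + 1 := by omega
  have h2 : 2 * (m + 1) = 2 * m + 1 + 1 := by omega
  rw [greenKernel, greenProfile, h1, h2, max_eq_right (sub_nonpos.2 h), zero_pow (by omega),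
    zero_sub, Finset.sum_Ico_eq_sum_range, ← Finset.sum_range_reflect,
    (by omega : 2 * m + 1 + 1 - (m + 1) = m + 1), ← Finset.sum_neg_distrib]
  congr 1
  refine Finset.sum_congr rfl fun k hk => ?_
  have hk := Finset.mem_range.1 hk
  rw [(by omega : m + 1 + (m + 1 - 1 - k) = 2 * m + 1 - k),
    (by omega : 2 * m + 1 - (2 * m + 1 - k) = k), Nat.choose_symm (by omega : k ≤ 2 * m + 1),
    neg_pow (y * (1 - x)), neg_pow (x * (1 - y))]
  have h3 : (-1 : ℝ) ^ (2 * m + 1 - k) = -(-1) ^ k := by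
    obtain ⟨j, hj⟩ : ∃ j, 2 * m + 1 = k + j := ⟨2 * m + 1 - k, by omega⟩
    have h4 : (-1 : ℝ) ^ k * (-1) ^ j = -1 := by
      rw [← pow_add, ← hj, pow_succ, pow_mul]; simp
    have h5 : (-1 : ℝ) ^ k * (-1) ^ k = 1 := by rw [← mul_pow]; simp
    rw [hj, Nat.add_sub_cancel_left]
    linear_combination (-1 : ℝ) ^ k * h4 - (-1) ^ j * h5
  rw [h3]
  ring

/-- The square root of the diagonal `G(x,x) = (x(1-x))^(2m+1) / ((2m+1) m!²)`, where `α = m + 1`. -/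
def sqrtGreenDiag (m : ℕ) (x : ℝ) : ℝ :=
  Real.sqrt (x * (1 - x)) ^ (2 * m + 1) / (Real.sqrt (2 * m + 1) * m.factorial)

lemma abs_greenKernel_le (m : ℕ) {x y : ℝ} (hx : x ∈ Icc (0 : ℝ) 1) (hy : y ∈ Icc (0 : ℝ) 1) :
    |greenKernel (m + 1) x y| ≤ sqrtGreenDiag m x * sqrtGreenDiag m y := by
  have key : ∀ {x y : ℝ}, x ∈ Icc (0 : ℝ) 1 → y ∈ Icc (0 : ℝ) 1 → y ≤ x →
      |greenProfile m (x * (1 - y)) (y * (1 - x))| ≤ sqrtGreenDiag m x * sqrtGreenDiag m y := by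
    intro x y hx hy hyx
    have hq : 0 ≤ y * (1 - x) := mul_nonneg hy.1 (sub_nonneg.2 hx.2)
    have hd : 0 ≤ x - y := sub_nonneg.2 hyx
    have hp : x * (1 - y) = y * (1 - x) + (x - y) := by ring
    rw [hp, abs_of_nonneg (greenProfile_nonneg m hd hq)]
    refine (greenProfile_le m hd hq).trans_eq ?_
    rw [← hp, (by ring : x * (1 - y) * (y * (1 - x)) = x * (1 - x) * (y * (1 - y))),
      Real.sqrt_mul (mul_nonneg hx.1 (sub_nonneg.2 hx.2)), sqrtGreenDiag, sqrtGreenDiag, mul_pow,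
      div_mul_div_comm]
    congr 1
    have : Real.sqrt (2 * m + 1) * Real.sqrt (2 * m + 1) = 2 * m + 1 :=
      Real.mul_self_sqrt (by positivity)
    linear_combination -((m.factorial : ℝ) ^ 2) * this
  rcases le_total y x with h | h
  · rw [greenKernel_of_le m h]
    exact key hx hy h
  · rw [greenKernel_of_ge m h, mul_comm (sqrtGreenDiag m x)]
    exact key hy hx h

/-- An integral operator whose kernel is dominated by a product `a(x) a(y)` has norm at most
`∫ a²`. -/
theorem IsIntegralOperator.norm_le {G : ℝ → ℝ → ℝ} {K : L2Unit →L[ℂ] L2Unit} {a : ℝ → ℝ}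
    (hG : ContinuousOn (fun p : ℝ × ℝ => G p.1 p.2) (Icc 0 1 ×ˢ Icc 0 1))
    (hK : IsIntegralOperator G K) (ha : ContinuousOn a (Icc 0 1))
    (hle : ∀ x ∈ Icc (0 : ℝ) 1, ∀ y ∈ Icc (0 : ℝ) 1, |G x y| ≤ a x * a y) :
    ‖K‖ ≤ ∫ x in (0 : ℝ)..1, a x ^ 2 := by
  have hac : ContinuousOn (fun x => (a x : ℂ)) (Icc 0 1) :=
    Complex.continuous_ofReal.comp_continuousOn ha
  have hsq : ∫ x in (0 : ℝ)..1, a x ^ 2 = ‖toL2Unit _ hac‖ ^ 2 := by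
    rw [norm_toL2Unit_sq]
    refine intervalIntegral.integral_congr fun x _ => ?_
    simp
  rw [hsq]
  refine K.opNorm_le_bound (by positivity) fun v => ?_
  have hpt : ∀ x ∈ Icc (0 : ℝ) 1, ‖∫ y in (0 : ℝ)..1, (G x y : ℂ) * v y‖ ≤
      ‖toL2Unit _ hac‖ * ‖v‖ * ‖(a x : ℂ)‖ := by
    intro x hx
    have hg : ContinuousOn (fun y => (G x y : ℂ)) (Icc 0 1) :=
      Complex.continuous_ofReal.comp_continuousOn (hG.comp (f := fun y => (x, y))
        (by fun_prop) fun y hy => ⟨hx, hy⟩)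
    have h1 : ∫ y in (0 : ℝ)..1, (G x y : ℂ) * v y = inner ℂ (toL2Unit _ hg) v := by
      rw [L2.inner_def, integral_eq_integral_Ioo]
      refine integral_congr_ae ?_
      filter_upwards [coeFn_toL2Unit hg] with y hy
      rw [hy]
      change _ = v y * star ((G x y : ℝ) : ℂ)
      rw [mul_comm]
      congr 1
      exact (Complex.conj_ofReal _).symm
    have h2 : ‖toL2Unit _ hg‖ ≤ ‖(a x : ℂ)‖ * ‖toL2Unit _ hac‖ := by
      refine Lp.norm_le_mul_norm_of_ae_le_mul ?_
      filter_upwards [coeFn_toL2Unit hg, coeFn_toL2Unit hac,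
        ae_restrict_Ioo_of_forall_Icc (hle x hx)] with y h3 h4 h5
      rw [h3, h4, ← norm_mul, ← Complex.ofReal_mul, Complex.norm_real, Complex.norm_real]
      exact h5.trans (le_abs_self _)
    rw [h1]
    refine (norm_inner_le_norm _ _).trans ?_
    calc _ ≤ ‖(a x : ℂ)‖ * ‖toL2Unit _ hac‖ * ‖v‖ := by gcongr
      _ = _ := by ring
  have h : ‖K v‖ ≤ ‖toL2Unit _ hac‖ * ‖v‖ * ‖toL2Unit _ hac‖ := by
    refine Lp.norm_le_mul_norm_of_ae_le_mul ?_
    filter_upwards [hK v, coeFn_toL2Unit hac, ae_restrict_Ioo_of_forall_Icc hpt] with x h1 h2 h3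
    rw [h1, h2]
    exact h3
  calc _ ≤ _ := h
    _ = _ := by ring

lemma integral_mul_one_sub_pow (m : ℕ) :
    ∫ x in (0 : ℝ)..1, (x * (1 - x)) ^ m = (m.factorial : ℝ) ^ 2 / (2 * m + 1).factorial := by
  have hre : 0 < ((m : ℂ) + 1).re := by simp; positivity
  have h := Complex.betaIntegral_eq_Gamma_mul_div ((m : ℂ) + 1) ((m : ℂ) + 1) hre hre
  have h2 : (m : ℂ) + 1 + ((m : ℂ) + 1) = ((2 * m + 1 : ℕ) : ℂ) + 1 := by push_cast; ring
  rw [h2, Complex.Gamma_nat_eq_factorial, Complex.Gamma_nat_eq_factorial,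
    Complex.betaIntegral] at h
  have h3 : ((∫ x in (0 : ℝ)..1, (x * (1 - x)) ^ m : ℝ) : ℂ) =
      (m.factorial : ℂ) * m.factorial / (2 * m + 1).factorial := by
    rw [← h, ← intervalIntegral.integral_ofReal]
    refine intervalIntegral.integral_congr fun x _ => ?_
    simp only [add_sub_cancel_right, Complex.cpow_natCast]
    push_cast
    rw [mul_pow]
  rw [sq]
  refine Complex.ofReal_injective (h3.trans ?_)
  push_cast
  rfl

lemma integral_sqrtGreenDiag_sq (m : ℕ) :
    ∫ x in (0 : ℝ)..1, sqrtGreenDiag m x ^ 2 =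
      ((2 * m + 1).factorial : ℝ) ^ 2 / (4 * m + 3).factorial /
        ((2 * m + 1) * (m.factorial : ℝ) ^ 2) := by
  have h : ∫ x in (0 : ℝ)..1, sqrtGreenDiag m x ^ 2 =
      ∫ x in (0 : ℝ)..1, (x * (1 - x)) ^ (2 * m + 1) / ((2 * m + 1) * (m.factorial : ℝ) ^ 2) := by
    refine intervalIntegral.integral_congr fun x hx => ?_
    rw [uIcc_of_le zero_le_one] at hx
    rw [sqrtGreenDiag, div_pow, mul_pow, Real.sq_sqrt (by positivity), ← pow_mul, mul_comm _ 2,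
      pow_mul, Real.sq_sqrt (mul_nonneg hx.1 (sub_nonneg.2 hx.2))]
  rw [h, intervalIntegral.integral_div, integral_mul_one_sub_pow,
    (by ring : 2 * (2 * m + 1) + 1 = 4 * m + 3)]

/-! ### The test function `(x(1-x))^α` -/

lemma iteratedDeriv_polynomial_eval_ofReal (p : Polynomial ℂ) (j : ℕ) :
    iteratedDeriv j (fun x : ℝ => p.eval (x : ℂ)) =
      fun x : ℝ => (Polynomial.derivative^[j] p).eval (x : ℂ) := by
  simpa using iteratedDeriv_primitiveFrom_add_polynomial (V := fun _ => 0) continuous_const 0 0 p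
    (le_refl j)

/-- The leading coefficient of `(X - X²)^α`, of degree `2α`, is `(-1)^α`. -/
lemma iterate_derivative_bubble (α : ℕ) :
    Polynomial.derivative^[2 * α] (((Polynomial.X - Polynomial.X ^ 2) ^ α : Polynomial ℂ)) =
      Polynomial.C ((-1) ^ α * ((2 * α).factorial : ℂ)) := by
  have hdeg : (Polynomial.X - Polynomial.X ^ 2 : Polynomial ℂ).natDegree ≤ 2 :=
    (Polynomial.natDegree_sub_le _ _).trans (by simp)
  ext i
  rw [Polynomial.coeff_iterate_derivative, Polynomial.coeff_C]
  split_ifs with hi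
  · have hc : ((Polynomial.X - Polynomial.X ^ 2 : Polynomial ℂ) ^ α).coeff (2 * α) = (-1) ^ α := by
      rw [mul_comm, Polynomial.coeff_pow_of_natDegree_le hdeg]
      simp [Polynomial.coeff_X]
    rw [hi, zero_add, Nat.descFactorial_self, hc, nsmul_eq_mul, mul_comm]
  · rw [Polynomial.coeff_eq_zero_of_natDegree_lt, smul_zero]
    have := Polynomial.natDegree_pow_le_of_le α hdeg
    omega

/-- The polynomial `(x(1-x))^α` solves the boundary value problem with constant right-hand side
`(2α)!`. -/
lemma solvesBVP_bubble (α : ℕ) :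
    SolvesBVP α (fun _ => ((2 * α).factorial : ℂ)) fun x => (((x * (1 - x)) ^ α : ℝ) : ℂ) := by
  set p : Polynomial ℂ := (Polynomial.X - Polynomial.X ^ 2) ^ α with hp
  have hfun : (fun x : ℝ => (((x * (1 - x)) ^ α : ℝ) : ℂ)) = fun x : ℝ => p.eval (x : ℂ) := by
    funext x
    rw [hp]
    simp only [Polynomial.eval_pow, Polynomial.eval_sub, Polynomial.eval_X]
    push_cast
    ring
  have hF := contDiff_polynomial_eval_ofReal p ((2 * α : ℕ) : WithTop ℕ∞)
  have hdvd : ∀ t : ℂ, (Polynomial.X - Polynomial.C t ∣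
      (Polynomial.X - Polynomial.X ^ 2 : Polynomial ℂ)) → ∀ j < α,
      (Polynomial.derivative^[j] p).eval t = 0 := fun t ht j hj =>
    eval_iterate_derivative_eq_zero (pow_dvd_pow_of_dvd ht α) hj
  rw [hfun]
  refine ⟨hF.contDiffOn, fun j hj => ⟨?_, ?_⟩, fun x hx => ?_⟩
  · rw [iteratedDerivWithin_Icc_eq hF (eqOn_refl _ _) (by omega) (by simp),
      iteratedDeriv_polynomial_eval_ofReal]
    refine hdvd _ ⟨1 - Polynomial.X, ?_⟩ j hj
    simp only [Complex.ofReal_zero, map_zero]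
    ring
  · rw [iteratedDerivWithin_Icc_eq hF (eqOn_refl _ _) (by omega) (by simp),
      iteratedDeriv_polynomial_eval_ofReal]
    refine hdvd _ ⟨-Polynomial.X, ?_⟩ j hj
    simp only [Complex.ofReal_one, map_one]
    ring
  · rw [iteratedDerivWithin_Icc_eq hF (eqOn_refl _ _) le_rfl hx,
      iteratedDeriv_polynomial_eval_ofReal, hp, iterate_derivative_bubble]
    simp only [Polynomial.eval_C]
    rw [← mul_assoc, ← mul_pow]
    simp

lemma integral_norm_bubble_sq (α : ℕ) :
    ∫ x in (0 : ℝ)..1, ‖(((x * (1 - x)) ^ α : ℝ) : ℂ)‖ ^ 2 =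
      ((2 * α).factorial : ℝ) ^ 2 / (4 * α + 1).factorial := by
  rw [(by ring : 4 * α + 1 = 2 * (2 * α) + 1), ← integral_mul_one_sub_pow]
  refine intervalIntegral.integral_congr fun x _ => ?_
  simp only [Complex.norm_real, Real.norm_eq_abs, sq_abs]
  ring

lemma integral_norm_iteratedDerivWithin_bubble_sq (α : ℕ) :
    ∫ x in (0 : ℝ)..1, ‖iteratedDerivWithin α (fun x : ℝ => (((x * (1 - x)) ^ α : ℝ) : ℂ))
      (Icc 0 1) x‖ ^ 2 = (α.factorial : ℝ) ^ 2 / (2 * α + 1) := by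
  have hb := solvesBVP_bubble α
  have h1 := hb.integral_mul_star hb.contDiffOn hb.2.1
  have hsq : ∀ z : ℂ, z * star z = ((‖z‖ ^ 2 : ℝ) : ℂ) := fun z => by
    push_cast; exact RCLike.mul_conj z
  have hstar : ∀ r : ℝ, star (r : ℂ) = r := Complex.conj_ofReal
  simp only [hsq, hstar, intervalIntegral.integral_const_mul] at h1
  rw [intervalIntegral.integral_ofReal, intervalIntegral.integral_ofReal,
    integral_mul_one_sub_pow] at h1
  have h2 : ((2 * α).factorial : ℝ) * ((α.factorial : ℝ) ^ 2 / (2 * α + 1).factorial) =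
      ∫ x in (0 : ℝ)..1, ‖iteratedDerivWithin α (fun x : ℝ => (((x * (1 - x)) ^ α : ℝ) : ℂ))
      (Icc 0 1) x‖ ^ 2 := by exact_mod_cast h1
  have h3 : ((2 * α).factorial : ℝ) ≠ 0 := by exact_mod_cast (2 * α).factorial_ne_zero
  rw [← h2, Nat.factorial_succ]
  push_cast
  field_simp

/-! ### Stirling's formula with a remainder -/

/-- Robbins' step bound telescopes: `log (stirlingSeq n) - 1 / (12 n)` increases with `n`. -/
lemma log_stirlingSeq_sub_le_add (n : ℕ) (hn : n ≠ 0) (k : ℕ) :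
    Real.log (Stirling.stirlingSeq n) - 1 / (12 * n) ≤
      Real.log (Stirling.stirlingSeq (n + k)) - 1 / (12 * ((n + k : ℕ) : ℝ)) := by
  induction k with
  | zero => simp
  | succ k ih =>
    refine ih.trans ?_
    have h := Stirling.log_stirlingSeq_sdiff_le (n + k)
    have hpos : (0 : ℝ) < ((n + k : ℕ) : ℝ) := by
      exact_mod_cast (by omega : 0 < n + k)
    have h2 : 1 / (12 * ((n + k : ℕ) : ℝ) * (((n + k : ℕ) : ℝ) + 1)) =
        1 / (12 * ((n + k : ℕ) : ℝ)) - 1 / (12 * (((n + k : ℕ) : ℝ) + 1)) := by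
      field_simp
      ring
    rw [h2] at h
    rw [← add_assoc n k 1, Nat.cast_succ]
    linarith

/-- The upper half of Robbins' form of Stirling's formula. -/
lemma stirlingSeq_le {n : ℕ} (hn : n ≠ 0) :
    Stirling.stirlingSeq n ≤ Real.sqrt Real.pi * Real.exp (1 / (12 * n)) := by
  have hπ : 0 < Real.sqrt Real.pi := Real.sqrt_pos.2 Real.pi_pos
  have hs : 0 < Stirling.stirlingSeq n := hπ.trans_le (Stirling.sqrt_pi_le_stirlingSeq hn)
  have hlim : Tendsto (fun k : ℕ => Real.log (Stirling.stirlingSeq (n + k)) -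
      1 / (12 * ((n + k : ℕ) : ℝ))) atTop (nhds (Real.log (Real.sqrt Real.pi) - 0)) := by
    have hshift : Tendsto (fun k : ℕ => n + k) atTop atTop := tendsto_atTop_mono
      (fun k => Nat.le_add_left k n) tendsto_id
    refine Tendsto.sub ?_ ?_
    · exact ((Stirling.tendsto_stirlingSeq_sqrt_pi.comp hshift).log hπ.ne')
    · refine Tendsto.comp (g := fun j : ℕ => 1 / (12 * (j : ℝ))) ?_ hshift
      exact tendsto_const_nhds.div_atTop
        (tendsto_natCast_atTop_atTop.const_mul_atTop (by norm_num))
  have h := ge_of_tendsto' hlim (log_stirlingSeq_sub_le_add n hn)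
  rw [← Real.exp_log hs, ← Real.exp_log hπ, ← Real.exp_add, Real.exp_le_exp]
  linarith

lemma factorial_eq_stirlingSeq_mul {n : ℕ} (hn : n ≠ 0) :
    (n.factorial : ℝ) = Stirling.stirlingSeq n * (Real.sqrt (2 * n) * (n / Real.exp 1) ^ n) := by
  have : (0 : ℝ) < n := by exact_mod_cast Nat.pos_of_ne_zero hn
  rw [Stirling.stirlingSeq, div_mul_cancel₀]
  positivity

/-- The factorial quotient `(4α)! (α!)² / ((2α)!)²`. -/
def factorialRatio (α : ℕ) : ℝ :=
  ((4 * α).factorial : ℝ) * (α.factorial : ℝ) ^ 2 / ((2 * α).factorial : ℝ) ^ 2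

lemma factorialRatio_pos (α : ℕ) : 0 < factorialRatio α := by
  unfold factorialRatio
  positivity

/-- The asymptotic main term `√(8πα) (4α/e)^(2α)`. -/
def mainTerm (α : ℕ) : ℝ :=
  Real.sqrt (8 * Real.pi * (α : ℝ)) * (4 * (α : ℝ) / Real.exp 1) ^ (2 * α)

lemma mainTerm_pos {α : ℕ} (hα : 1 ≤ α) : 0 < mainTerm α := by
  have : (0 : ℝ) < α := by exact_mod_cast hα
  have := Real.pi_pos
  unfold mainTerm
  positivity

lemma two_mul_factorialRatio_eq {α : ℕ} (hα : 1 ≤ α) :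
    2 * factorialRatio α = Stirling.stirlingSeq (4 * α) * Stirling.stirlingSeq α ^ 2 /
      (Stirling.stirlingSeq (2 * α) ^ 2 * Real.sqrt Real.pi) * mainTerm α := by
  have ha : (0 : ℝ) < α := by exact_mod_cast hα
  have hπ : 0 < Real.sqrt Real.pi := Real.sqrt_pos.2 Real.pi_pos
  have h8 : Real.sqrt (8 * Real.pi * α) = Real.sqrt Real.pi * Real.sqrt (8 * α) := by
    rw [← Real.sqrt_mul Real.pi_pos.le]
    congr 1
    ring
  have h2 : 0 < Stirling.stirlingSeq (2 * α) :=
    hπ.trans_le (Stirling.sqrt_pi_le_stirlingSeq (by omega))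
  rw [factorialRatio, mainTerm, h8, factorial_eq_stirlingSeq_mul (by omega : 4 * α ≠ 0),
    factorial_eq_stirlingSeq_mul (by omega : α ≠ 0),
    factorial_eq_stirlingSeq_mul (by omega : 2 * α ≠ 0)]
  push_cast
  have hs1 : Real.sqrt (2 * α) ^ 2 = 2 * α := Real.sq_sqrt (by positivity)
  have hs2 : Real.sqrt (2 * (2 * α)) ^ 2 = 4 * α := by
    rw [Real.sq_sqrt (by positivity)]
    ring
  rw [(by ring : (2 * (4 * α) : ℝ) = 8 * α)]
  simp only [mul_pow, hs1, hs2]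
  have he := Real.exp_pos 1
  have hpow : (4 * (α : ℝ) / Real.exp 1) ^ (4 * α) * ((α / Real.exp 1) ^ α) ^ 2 =
      (4 * (α : ℝ) / Real.exp 1) ^ (2 * α) * ((2 * α / Real.exp 1) ^ (2 * α)) ^ 2 := by
    calc _ = ((4 * (α : ℝ) / Real.exp 1) ^ 4 * (α / Real.exp 1) ^ 2) ^ α := by
          rw [mul_pow, ← pow_mul, ← pow_mul, ← pow_mul, mul_comm α 2]
      _ = ((4 * (α : ℝ) / Real.exp 1) ^ 2 * (2 * α / Real.exp 1) ^ 4) ^ α := by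
          congr 1
          field_simp
          ring
      _ = _ := by
          rw [mul_pow, ← pow_mul, ← pow_mul, ← pow_mul]
          congr 2
          ring
  have hne : (2 * (α : ℝ) / Real.exp 1) ^ (2 * α) ≠ 0 := by positivity
  field_simp
  linear_combination 4 * Stirling.stirlingSeq (4 * α) * Stirling.stirlingSeq α ^ 2 * hpow

lemma two_mul_factorialRatio_le {α : ℕ} (hα : 1 ≤ α) :
    2 * factorialRatio α ≤ (1 + 1 / α) * mainTerm α := by
  have ha : (1 : ℝ) ≤ α := by exact_mod_cast hα
  have hπ : 0 < Real.sqrt Real.pi := Real.sqrt_pos.2 Real.pi_pos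
  rw [two_mul_factorialRatio_eq hα]
  refine mul_le_mul_of_nonneg_right ?_ (mainTerm_pos hα).le
  have h1 := stirlingSeq_le (by omega : α ≠ 0)
  have h4 := stirlingSeq_le (by omega : 4 * α ≠ 0)
  have h2 := Stirling.sqrt_pi_le_stirlingSeq (by omega : 2 * α ≠ 0)
  have h0 : 0 ≤ Stirling.stirlingSeq α :=
    hπ.le.trans (Stirling.sqrt_pi_le_stirlingSeq (by omega))
  -- exponents: `1/(48α) + 2/(12α) = 3/(16α)`
  have hexp : Real.exp (1 / (12 * (4 * α : ℕ))) * Real.exp (1 / (12 * α)) ^ 2 =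
      Real.exp (3 / (16 * α)) := by
    rw [← Real.exp_nat_mul, ← Real.exp_add]
    congr 1
    push_cast
    field_simp
    ring
  calc _ ≤ Real.sqrt Real.pi * Real.exp (1 / (12 * (4 * α : ℕ))) *
        (Real.sqrt Real.pi * Real.exp (1 / (12 * α))) ^ 2 /
        (Real.sqrt Real.pi ^ 2 * Real.sqrt Real.pi) := by gcongr
    _ = Real.exp (1 / (12 * (4 * α : ℕ))) * Real.exp (1 / (12 * α)) ^ 2 := by field_simp
    _ = Real.exp (3 / (16 * α)) := hexp
    _ ≤ 1 + 1 / α := by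
      -- `exp t ≤ 1 / (1 - t)` with `t = 3 / (16 α)`
      have ht : 3 / (16 * (α : ℝ)) ≤ 3 / 16 := by
        gcongr
        linarith
      have ht0 : 0 ≤ 3 / (16 * (α : ℝ)) := by positivity
      have h5 : (1 : ℝ) / α = 16 / 3 * (3 / (16 * α)) := by field_simp
      have h6 := Real.add_one_le_exp (-(3 / (16 * (α : ℝ))))
      have h7 := Real.exp_pos (3 / (16 * (α : ℝ)))
      have h8 : Real.exp (3 / (16 * (α : ℝ))) * Real.exp (-(3 / (16 * (α : ℝ)))) = 1 := by
        rw [← Real.exp_add, add_neg_cancel, Real.exp_zero]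
      rw [h5]
      nlinarith

lemma le_two_mul_factorialRatio {α : ℕ} (hα : 1 ≤ α) :
    (1 - 1 / (12 * α)) * mainTerm α ≤ 2 * factorialRatio α := by
  have ha : (1 : ℝ) ≤ α := by exact_mod_cast hα
  have hπ : 0 < Real.sqrt Real.pi := Real.sqrt_pos.2 Real.pi_pos
  rw [two_mul_factorialRatio_eq hα]
  refine mul_le_mul_of_nonneg_right ?_ (mainTerm_pos hα).le
  have h1 := Stirling.sqrt_pi_le_stirlingSeq (by omega : α ≠ 0)
  have h4 := Stirling.sqrt_pi_le_stirlingSeq (by omega : 4 * α ≠ 0)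
  have h2 := stirlingSeq_le (by omega : 2 * α ≠ 0)
  have h0 : 0 < Stirling.stirlingSeq (2 * α) :=
    hπ.trans_le (Stirling.sqrt_pi_le_stirlingSeq (by omega))
  have hexp : Real.exp (1 / (12 * (2 * α : ℕ))) ^ 2 = Real.exp (1 / (12 * α)) := by
    rw [← Real.exp_nat_mul]
    congr 1
    push_cast
    field_simp
  calc _ ≤ Real.exp (-(1 / (12 * α))) := by
        have := Real.add_one_le_exp (-(1 / (12 * (α : ℝ))))
        linarith
    _ = Real.sqrt Real.pi * Real.sqrt Real.pi ^ 2 /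
        ((Real.sqrt Real.pi * Real.exp (1 / (12 * (2 * α : ℕ)))) ^ 2 * Real.sqrt Real.pi) := by
      rw [mul_pow, hexp, Real.exp_neg]
      field_simp
    _ ≤ _ := by
      have h3 := hπ.le.trans h4
      gcongr

/-! ### Bounds for the norm of the Green operator -/

/-- The trace bound for the Green operator. -/
lemma norm_le_of_isIntegralOperator_greenKernel {α : ℕ} (hα : 1 ≤ α) {K : L2Unit →L[ℂ] L2Unit}
    (hK : IsIntegralOperator (greenKernel α) K) :
    ‖K‖ ≤ (α / (2 * α - 1)) / factorialRatio α := by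
  obtain ⟨m, rfl⟩ : ∃ m, α = m + 1 := ⟨α - 1, by omega⟩
  have ha : ContinuousOn (sqrtGreenDiag m) (Icc 0 1) := by
    refine Continuous.continuousOn ?_
    unfold sqrtGreenDiag
    fun_prop
  refine (hK.norm_le (continuous_greenKernel (m + 1)).continuousOn ha
    fun x hx y hy => abs_greenKernel_le m hx hy).trans_eq ?_
  rw [integral_sqrtGreenDiag_sq, factorialRatio, (by ring : 4 * (m + 1) = 4 * m + 3 + 1),
    (by ring : 2 * (m + 1) = 2 * m + 1 + 1), Nat.factorial_succ (4 * m + 3),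
    Nat.factorial_succ (2 * m + 1), Nat.factorial_succ m]
  push_cast
  have h1 : (2 * ((m : ℝ) + 1) - 1) = 2 * m + 1 := by ring
  rw [h1]
  field_simp
  ring

/-- The inequality tested with `(x(1-x))^α`. -/
lemma le_of_mem_wirtingerSobolevConstants {α : ℕ} {C : ℝ}
    (hC : C ∈ wirtingerSobolevConstants α) :
    ((2 * α + 1) / (4 * α + 1)) / factorialRatio α ≤ C := by
  have hb := solvesBVP_bubble α
  have h := hC _ hb.contDiffOn hb.2.1
  rw [integral_norm_bubble_sq, integral_norm_iteratedDerivWithin_bubble_sq,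
    ← div_le_iff₀ (by positivity)] at h
  refine le_of_eq_of_le ?_ h
  rw [factorialRatio, Nat.factorial_succ (4 * α)]
  push_cast
  field_simp

end

theorem mainTheorem1 :
    -- the equivalent descriptions of the constant
    (∀ α : ℕ, 1 ≤ α →
      IsLeast (dirichletEigenvalues α) (cConst α) ∧
      (∃! K : L2Unit →L[ℂ] L2Unit, IsGreenOperator α K) ∧
      (∀ K : L2Unit →L[ℂ] L2Unit, IsGreenOperator α K → cConst α = 1 / ‖K‖) ∧
      IsLeast (wirtingerSobolevConstants α) (1 / cConst α)) ∧
    -- the asymptotics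
    (∃ ε : ℕ → ℝ,
      (ε =O[atTop] fun α : ℕ => 1 / Real.sqrt (α : ℝ)) ∧
      ∀ α : ℕ, 1 ≤ α →
        cConst α = Real.sqrt (8 * Real.pi * (α : ℝ)) *
          (4 * (α : ℝ) / Real.exp 1) ^ (2 * α) * (1 + ε α)) ∧
    -- the explicit bounds
    (∀ α : ℕ, 1 ≤ α →
      (4 * (α : ℝ) - 2) / (4 * (α : ℝ) ^ 2 - (α : ℝ)) *
          (((4 * α).factorial : ℝ) * (α.factorial : ℝ) ^ 2 / ((2 * α).factorial : ℝ) ^ 2)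
        ≤ cConst α ∧
      cConst α ≤ (4 * (α : ℝ) + 1) / (2 * (α : ℝ) + 1) *
          (((4 * α).factorial : ℝ) * (α.factorial : ℝ) ^ 2 / ((2 * α).factorial : ℝ) ^ 2)) := by
  have hmain : ∀ α : ℕ, 1 ≤ α → ∃ K : L2Unit →L[ℂ] L2Unit, IsGreenOperator α K ∧
      ((2 * α + 1) / (4 * α + 1)) / factorialRatio α ≤ ‖K‖ ∧
      ‖K‖ ≤ (α / (2 * α - 1)) / factorialRatio α ∧
      IsLeast (dirichletEigenvalues α) (1 / ‖K‖) ∧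
      IsLeast (wirtingerSobolevConstants α) ‖K‖ := by
    intro α hα
    have hG := isGreenKernel_greenKernel hα
    obtain ⟨K, hK, -⟩ := exists_isIntegralOperator hG.1
    have hW := norm_mem_wirtingerSobolevConstants hG hK
    have hlow := le_of_mem_wirtingerSobolevConstants hW
    have hpos : 0 < ‖K‖ := by
      have := factorialRatio_pos α
      exact lt_of_lt_of_le (by positivity) hlow
    have hmem := one_div_norm_mem_dirichletEigenvalues hG hK hpos
    refine ⟨K, ⟨_, hG, hK⟩, hlow, norm_le_of_isIntegralOperator_greenKernel hα hK,
      ⟨hmem, fun l hl => one_div_le_of_mem_dirichletEigenvalues hpos hW hl⟩,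
      hW, fun C hC => ?_⟩
    -- the value at the test function `(x(1-x))^α` forces every admissible constant to be positive
    have hCpos : 0 < C := by
      have := factorialRatio_pos α
      exact lt_of_lt_of_le (by positivity) (le_of_mem_wirtingerSobolevConstants hC)
    exact (one_div_le_one_div hCpos hpos).1
      (one_div_le_of_mem_dirichletEigenvalues hCpos hC hmem)
  have hbounds : ∀ α : ℕ, 1 ≤ α →
      (2 * α - 1) / α * factorialRatio α ≤ cConst α ∧
      cConst α ≤ (4 * α + 1) / (2 * α + 1) * factorialRatio α := by
    intro α hα
    obtain ⟨K, -, hlow, hup, hE, -⟩ := hmain α hα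
    have ha : (1 : ℝ) ≤ α := by exact_mod_cast hα
    have hr := factorialRatio_pos α
    have hd : (0 : ℝ) < 2 * α - 1 := by linarith
    have hpos : 0 < ‖K‖ := lt_of_lt_of_le (by positivity) hlow
    rw [cConst, hE.csInf_eq]
    constructor
    · refine le_of_eq_of_le ?_ (one_div_le_one_div_of_le hpos hup)
      field_simp
    · refine (one_div_le_one_div_of_le (by positivity) hlow).trans_eq ?_
      field_simp
  refine ⟨fun α hα => ?_, ⟨fun α => cConst α / mainTerm α - 1, ?_, fun α hα => ?_⟩,
    fun α hα => ?_⟩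
  · obtain ⟨K, hK, -, -, hE, hW⟩ := hmain α hα
    have hc : cConst α = 1 / ‖K‖ := hE.csInf_eq
    refine ⟨hc ▸ hE, ⟨K, hK, fun K' hK' => hK'.unique hK⟩, fun K' hK' => ?_, ?_⟩
    · rw [hK'.unique hK, hc]
    · rw [hc, one_div_one_div]
      exact hW
  · refine IsBigO.of_bound 1 (eventually_atTop.2 ⟨1, fun α hα => ?_⟩)
    obtain ⟨hlow, hup⟩ := hbounds α hα
    have ha : (1 : ℝ) ≤ α := by exact_mod_cast hα
    have hM := mainTerm_pos hα
    have hr := factorialRatio_pos α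
    have h1 := two_mul_factorialRatio_le hα
    have h2 := le_two_mul_factorialRatio hα
    have hinv : 0 ≤ 1 / (α : ℝ) ∧ 1 / (α : ℝ) ≤ 1 :=
      ⟨by positivity, (div_le_one (by linarith)).2 ha⟩
    have hup' : cConst α ≤ (1 + 1 / α) * mainTerm α := by
      have h3 : (4 * (α : ℝ) + 1) / (2 * α + 1) ≤ 2 := by
        rw [div_le_iff₀ (by positivity)]
        linarith
      exact hup.trans ((mul_le_mul_of_nonneg_right h3 hr.le).trans h1)
    have hlow' : (1 - 1 / α) * mainTerm α ≤ cConst α := by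
      have h3 : (2 * (α : ℝ) - 1) / α * factorialRatio α =
          (1 - 1 / α / 2) * (2 * factorialRatio α) := by
        field_simp
      have h4 : (1 : ℝ) / (12 * α) = 1 / α / 12 := by field_simp
      rw [h3] at hlow
      rw [h4] at h2
      refine le_trans ?_ (le_trans (mul_le_mul_of_nonneg_left h2 (by linarith)) hlow)
      rw [← mul_assoc]
      refine mul_le_mul_of_nonneg_right ?_ hM.le
      nlinarith [hinv.1, mul_nonneg hinv.1 hinv.1]
    have hsqrt : 1 / (α : ℝ) ≤ 1 / Real.sqrt α :=
      one_div_le_one_div_of_le (Real.sqrt_pos.2 (by linarith))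
        (Real.sqrt_le_iff.2 ⟨by linarith, by nlinarith⟩)
    rw [one_mul, Real.norm_eq_abs, Real.norm_of_nonneg (by positivity)]
    refine le_trans (abs_le.2 ⟨?_, ?_⟩) hsqrt
    · have := (le_div_iff₀ hM).2 hlow'
      linarith
    · have := (div_le_iff₀ hM).2 hup'
      linarith
  · have hM := mainTerm_pos hα
    change cConst α = mainTerm α * (1 + (cConst α / mainTerm α - 1))
    field_simp
    ring
  · obtain ⟨hlow, hup⟩ := hbounds α hα
    refine ⟨le_trans (mul_le_mul_of_nonneg_right ?_ (factorialRatio_pos α).le) hlow, hup⟩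
    have ha : (1 : ℝ) ≤ α := by exact_mod_cast hα
    -- the trace bound is stronger than the stated one by the factor `(4 * α - 1) / 2`
    rw [div_le_div_iff₀ (by nlinarith) (by positivity)]
    have h1 : 0 ≤ (2 * (α : ℝ) - 1) * α * (4 * α - 3) := by
      have : (0 : ℝ) ≤ 4 * α - 3 := by linarith
      have : (0 : ℝ) ≤ 2 * α - 1 := by linarith
      positivity
    nlinarith
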